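/- Let $(R,\mathfrak m,k)$ be a commutative Noetherian local ring of Krull dimension $d$. Assume that $R$ is Cohen--Macaulay (i.e. $\operatorname{depth} R=d$) and has minimal multiplicity, i.e. $e(R)=\mu(\mathfrak m)-d+1$, where $\mu(\mathfrak m)$ is the minimal number of generators of $\mathfrak m$ and $e(R)$ is $d!$ times the leading coefficient of the Hilbert--Samuel polynomial $P$ of $R$ (the polynomial with $P(n)=\operatorname{length}_R(R/\mathfrak m^{n+1})$ for all $n\gg 0$). For $n\ge 0$ let $\Omega_n^R(k)$ denote the $n$th syzygy module of $k$, i.e. the image of the $n$th differential of an augmented minimal free resolution $\cdots\to F_1\to F_0\to k\to 0$ of $k$ (so $\Omega_0^R(k)=k$). Let $M$ and $N$ be non-zero maximal Cohen--Macaulay $R$-modules (finitely generated modules of depth $d$), possibly equal, each of which is a homomorphic image of a finite direct sum of syzygy modules $\Omega_n^R(k)$, $n\ge 0$ (with varying $n$ and repetitions allowed). Then the following statements are equivalent: 1. $\operatorname{Ext}_R^i(M,N)=0$ for some $d+1$ consecutive values of $i\ge 1$; 2. $\operatorname{Ext}_R^i(M,N)=0$ for all $i\ge 1$; 3. $R$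 is regular; 4. $\operatorname{Tor}_i^R(M,N)=0$ for some $d+1$ consecutive values of $i\ge 1$; 5. $\operatorname{Tor}_i^R(M,N)=0$ for all $i\ge 1$. -/

import Mathlib

open CategoryTheory IsLocalRing
open scoped DirectSum

universe u

noncomputable section

namespace MinMult

section Ring

variable (R : Type u) [CommRing R] [IsLocalRing R]

/-- The depth of a module over a local ring: the supremum of the lengths of the `M`-regular
sequences contained in the maximal ideal. -/
def depth (M : Type u) [AddCommGroup M] [Module R M] : ℕ∞ :=
  ⨆ rs : {rs : List R // RingTheory.Sequence.IsRegular M rs ∧ ∀ r ∈ rs, r ∈ maximalIdeal R},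
    (rs.1.length : ℕ∞)

/-- A local ring is Cohen-Macaulay if its depth equals its Krull dimension. -/
def IsCohenMacaulay : Prop :=
  (depth R R : WithBot ℕ∞) = ringKrullDim R

/-- A (non-zero) module is maximal Cohen-Macaulay if it is finitely generated and its depth
equals the Krull dimension of the ring. -/
structure IsMaximalCohenMacaulay (M : Type u) [AddCommGroup M] [Module R M] : Prop where
  finite : Module.Finite R M
  depth_eq : (depth R M : WithBot ℕ∞) = ringKrullDim R

/-- The Krull dimension as a natural number (it is finite for a Noetherian local ring). -/
def dim : ℕ := ((ringKrullDim R).unbotD 0).toNat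

/-- `P` is the Hilbert-Samuel polynomial of `R`: `P(n)` is the length of `R / 𝔪 ^ (n + 1)` for all
large `n`. The length is finite when `R` is Noetherian. -/
def IsHilbertSamuelPolynomial (P : Polynomial ℚ) : Prop :=
  ∀ᶠ n : ℕ in Filter.atTop,
    ((Module.length R (R ⧸ maximalIdeal R ^ (n + 1))).toNat : ℚ) = P.eval (n : ℚ)

open Classical in
/-- The multiplicity `e(R)`: the normalized leading coefficient (that is, `d!` times the leading
coefficient, where `d` is the dimension of `R`) of the Hilbert-Samuel polynomial.
The polynomial exists for every Noetherian local ring, and it is unique. -/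
def samuelMultiplicity : ℚ :=
  if h : ∃ P, IsHilbertSamuelPolynomial R P then
    ((dim R).factorial : ℚ) * h.choose.leadingCoeff
  else 0

/-- Minimal multiplicity: `e(R) = μ(𝔪) - dim R + 1`. -/
def HasMinimalMultiplicity : Prop :=
  samuelMultiplicity R = ((maximalIdeal R).spanFinrank : ℚ) - (dim R : ℚ) + 1

/-- An augmented minimal free resolution
`⋯ ⟶ R ^ (rank 2) ⟶ R ^ (rank 1) ⟶ R ^ (rank 0) ⟶ M ⟶ 0` of a module over a local ring. -/
structure MinimalFreeResolution (M : Type u) [AddCommGroup M] [Module R M] where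
  /-- the ranks of the free modules -/
  rank : ℕ → ℕ
  /-- the differentials -/
  d : ∀ n, (Fin (rank (n + 1)) → R) →ₗ[R] (Fin (rank n) → R)
  /-- the augmentation -/
  ε : (Fin (rank 0) → R) →ₗ[R] M
  surjective_ε : Function.Surjective ε
  exact_ε : Function.Exact (d 0) ε
  exact_d : ∀ n, Function.Exact (d (n + 1)) (d n)
  minimal : ∀ n, LinearMap.range (d n) ≤ maximalIdeal R • (⊤ : Submodule R (Fin (rank n) → R))

variable {R}

/-- The `n`-th syzygy module: the image of the `n`-th differential of the augmented minimal free
resolution, the `0`-th differential being the augmentation. -/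
def MinimalFreeResolution.syzygy {M : Type u} [AddCommGroup M] [Module R M]
    (F : MinimalFreeResolution R M) : ℕ → ModuleCat.{u} R
  | 0 => ModuleCat.of R (LinearMap.range F.ε)
  | n + 1 => ModuleCat.of R (LinearMap.range (F.d n))

variable (R)

/-- `M` is a homomorphic image of a finite direct sum of syzygy modules of the residue field. -/
def IsImageOfSyzygies (M : Type u) [AddCommGroup M] [Module R M] : Prop :=
  ∃ (F : MinimalFreeResolution R (ResidueField R)) (r : ℕ) (n : Fin r → ℕ)
    (f : (⨁ i : Fin r, F.syzygy (n i)) →ₗ[R] M), Function.Surjective f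

end Ring

section ExtTor

variable (R : Type u) [CommRing R] (M N : Type u) [AddCommGroup M] [Module R M]
  [AddCommGroup N] [Module R N]

/-- `Ext_R^i(M, N) = 0`. -/
def ExtVanishes (i : ℕ) : Prop :=
  Subsingleton (Abelian.Ext (ModuleCat.of R M) (ModuleCat.of R N) i)

/-- `Tor_i^R(M, N) = 0`. -/
def TorVanishes (i : ℕ) : Prop :=
  Limits.IsZero (((Tor (ModuleCat.{u} R) i).obj (ModuleCat.of R M)).obj (ModuleCat.of R N))

end ExtTor

end MinMult

end

/-! After a faithfully flat base change `R → S = R(X)` with infinite residue field and `𝔪S = 𝔪_S`, a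
sequence `xs` of `d` superficial elements can be chosen that is regular on `S`, `S ⊗ M` and `S ⊗ N`,
is independent modulo `𝔪_S ^ 2`, and has `length (S/(xs)) = e(R)`
(`exists_isWeaklyRegular_length_eq_multiplicity`). Since `length (S/𝔪_S ^ 2) = μ + 1` and each
member of `xs` lowers this length by at most one, minimal multiplicity forces `𝔪_S ^ 2 ⊆ (xs)`;
moreover `R` is regular iff `e(R) = 1` iff `𝔪_S ⊆ (xs)`
(`exists_isWeaklyRegular_maximalIdeal_sq_le`).

Modulo `xs`, the syzygies of `k` become vector spaces (`mem_range_sup_of_map_mem`,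
`MinimalFreeResolution.maximalIdeal_smul_le`), and so do all their quotients; hence `𝔪_S` kills
`M/(xs)M` and `N/(xs)N` after base change.

Let `F` be a minimal free resolution of `M`. Vanishing of `d + 1` consecutive `Ext` modules makes
`Hom(F, N)` exact at `d + 1` consecutive spots. Dividing out one regular element costs one spot, so
modulo `xs` one spot remains exact. The differentials there vanish, because their entries lie in `𝔪`
and `N/(xs)N` is a nonzero vector space; so some `F_j` is zero. The argument for `Tor` is the same,
with `N` resolved.

A finite resolution gives regularity: the last nonzero differential `F_{p-1} → F_{p-2}` is injective
with `xs`-regular cokernel and sends `𝔪 F_{p-1}` into `𝔪 ^ 2 F_{p-2} ⊆ (xs) F_{p-2}`, so `𝔪 F_{p-1}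
⊆ (xs) F_{p-1}` and `𝔪_S ⊆ (xs)`. If there is no such differential, `M` is free and `𝔪M ⊆ (xs)M`
gives the same inclusion. Conversely, if `𝔪_S ⊆ (xs)`, Nakayama shows that `M` and `N` are free, and
all higher `Ext` and `Tor` vanish. -/

noncomputable section

namespace MinMult

open RingTheory.Sequence TensorProduct

/-! ### Depth and quotients by an arbitrary regular element -/

section Depth

variable {R : Type*} [CommRing R] [IsLocalRing R]

/-- The module `M` admits a weakly regular sequence of length `n` in the maximal ideal. -/
def HasDepth (R : Type*) [CommRing R] [IsLocalRing R] (n : ℕ)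
    (M : Type*) [AddCommGroup M] [Module R M] : Prop :=
  ∃ rs : List R, rs.length = n ∧ (∀ r ∈ rs, r ∈ maximalIdeal R) ∧ IsWeaklyRegular M rs

/-- No non-zero element of `M` is killed by the maximal ideal. -/
def SocleTrivial (R : Type*) [CommRing R] [IsLocalRing R]
    (M : Type*) [AddCommGroup M] [Module R M] : Prop :=
  ∀ u : M, (∀ a ∈ maximalIdeal R, a • u = 0) → u = 0

variable {M : Type*} [AddCommGroup M] [Module R M]

lemma SocleTrivial.of_isSMulRegular {x : R} (hx : x ∈ maximalIdeal R) (h : IsSMulRegular M x) :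
    SocleTrivial R M :=
  fun _ hu ↦ h.right_eq_zero_of_smul (hu x hx)

lemma HasDepth.socleTrivial {n : ℕ} (h : HasDepth R (n + 1) M) : SocleTrivial R M := by
  obtain ⟨rs, hl, hm, hr⟩ := h
  match rs, hl with
  | r :: rs, _ =>
    exact .of_isSMulRegular (hm r (by simp)) ((isWeaklyRegular_cons_iff M r rs).mp hr).1

lemma SocleTrivial.not_le_of_mem_associatedPrimes [IsNoetherianRing R] (h : SocleTrivial R M)
    {p : Ideal R} (hp : p ∈ associatedPrimes R M) : ¬ maximalIdeal R ≤ p := by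
  obtain ⟨hpp, u, rfl⟩ := isAssociatedPrime_iff.mp hp
  intro hle
  have hu : u = 0 := h u fun a ha ↦ by
    simpa [Submodule.mem_colon_singleton] using hle ha
  exact hpp.ne_top (by simp [hu])

/-- Prime avoidance over the finitely many associated primes of both modules, none of which contains
`𝔪`. -/
lemma SocleTrivial.exists_isSMulRegular [IsNoetherianRing R] [Module.Finite R M]
    {N : Type*} [AddCommGroup N] [Module R N] [Module.Finite R N]
    (hM : SocleTrivial R M) (hN : SocleTrivial R N) :
    ∃ z ∈ maximalIdeal R, IsSMulRegular M z ∧ IsSMulRegular N z := by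
  have hfin := (associatedPrimes.finite R M).union (associatedPrimes.finite R N)
  have key : ¬ ((maximalIdeal R : Set R) ⊆
      ⋃ p ∈ associatedPrimes R M ∪ associatedPrimes R N, (id p : Ideal R)) := by
    rw [Ideal.subset_union_prime_finite hfin ⊤ ⊤]
    · rintro ⟨p, hp | hp, hle⟩
      · exact hM.not_le_of_mem_associatedPrimes hp hle
      · exact hN.not_le_of_mem_associatedPrimes hp hle
    · rintro p (hp | hp) - -
      exacts [hp.1, hp.1]
  obtain ⟨z, hz, hz'⟩ := Set.not_subset.mp key
  rw [Set.biUnion_union] at hz'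
  simp only [id] at hz'
  rw [biUnion_associatedPrimes_eq_compl_regular, biUnion_associatedPrimes_eq_compl_regular] at hz'
  simp only [Set.mem_union, Set.mem_compl_iff, not_or, not_not] at hz'
  exact ⟨z, hz, hz'.1, hz'.2⟩

open Pointwise in
-- This is the elementary form of `Hom(k, M/xM) ≅ Ext¹(k, M) ≅ Hom(k, M/yM)`: a socle class `u`
-- modulo `x` is sent to the class modulo `y` of the `v` with `y u = x v`.
lemma SocleTrivial.quotSMulTop {x y : R} (hxM : IsSMulRegular M x)
    (hy : y ∈ maximalIdeal R) (hyM : IsSMulRegular M y)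
    (h : SocleTrivial R (QuotSMulTop y M)) : SocleTrivial R (QuotSMulTop x M) := by
  intro u hu
  obtain ⟨u, rfl⟩ := Submodule.mkQ_surjective _ u
  have mem (z : R) (w : M) : (z • (⊤ : Submodule R M)).mkQ w = 0 ↔ ∃ w', z • w' = w := by
    simp [Submodule.mem_smul_pointwise_iff_exists]
  simp_rw [← map_smul] at hu
  obtain ⟨v, hv⟩ := (mem _ _).mp (hu y hy)
  have hv0 : (y • (⊤ : Submodule R M)).mkQ v = 0 := by
    refine h _ fun a ha ↦ ?_
    rw [← map_smul, mem]
    obtain ⟨w, hw⟩ := (mem _ _).mp (hu a ha)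
    refine ⟨w, hxM ?_⟩
    simp only
    rw [smul_comm x a, hv, smul_comm a y, ← hw, smul_comm]
  obtain ⟨w, rfl⟩ := (mem _ _).mp hv0
  rw [mem]
  refine ⟨w, hyM ?_⟩
  simp only
  rw [← hv, smul_comm]

/-- An exchange argument: an element `z` regular on both `M/xM` and `M/yM` links `x` to the given
first element `y`, since regular sequences in `𝔪` may be permuted. -/
lemma HasDepth.quotSMulTop [IsNoetherianRing R] [Module.Finite R M] {n : ℕ}
    (h : HasDepth R (n + 1) M) {x : R} (hx : x ∈ maximalIdeal R) (hxM : IsSMulRegular M x) :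
    HasDepth R n (QuotSMulTop x M) := by
  induction n generalizing M x with
  | zero => exact ⟨[], rfl, by simp, IsWeaklyRegular.nil _ _⟩
  | succ n ih =>
    obtain ⟨rs, hl, hm, hr⟩ := h
    match rs, hl with
    | y :: ys, hl =>
      have hy : y ∈ maximalIdeal R := hm y (by simp)
      obtain ⟨hyM, hys⟩ := (isWeaklyRegular_cons_iff M y ys).mp hr
      have hMy : HasDepth R (n + 1) (QuotSMulTop y M) :=
        ⟨ys, by simpa using hl, fun r hr ↦ hm r (by simp [hr]), hys⟩
      obtain ⟨z, hz, hzx, hzy⟩ := SocleTrivial.exists_isSMulRegular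
        (hMy.socleTrivial.quotSMulTop hxM hy hyM) hMy.socleTrivial
      obtain ⟨zs, hzl, hzm, hzr⟩ := ih hMy hz hzy
      have h₁ : IsWeaklyRegular M (z :: y :: zs) := by
        refine IsLocalRing.isWeaklyRegular_of_perm_of_subset_maximalIdeal
          (IsWeaklyRegular.cons hyM (IsWeaklyRegular.cons hzy hzr)) (.swap z y zs) ?_
        exact List.forall_mem_cons.mpr ⟨hy, List.forall_mem_cons.mpr ⟨hz, hzm⟩⟩
      obtain ⟨hzM, h₂⟩ := (isWeaklyRegular_cons_iff M z _).mp h₁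
      have h₃ : IsWeaklyRegular M [z, x] := by
        refine IsLocalRing.isWeaklyRegular_of_perm_of_subset_maximalIdeal
          (IsWeaklyRegular.cons hxM (IsWeaklyRegular.cons hzx (.nil _ _))) (.swap z x []) ?_
        exact List.forall_mem_cons.mpr ⟨hx, List.forall_mem_singleton.mpr hz⟩
      obtain ⟨-, h₄⟩ := (isWeaklyRegular_cons_iff M z _).mp h₃
      have hxz := ((isWeaklyRegular_cons_iff _ x _).mp h₄).1
      -- `M/zM` has the regular sequence `y :: zs` and the regular element `x`, so the induction
      -- hypothesis replaces `y` by `x`.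
      obtain ⟨ws, hwl, hwm, hwr⟩ := ih (M := QuotSMulTop z M)
        ⟨y :: zs, by simp [hzl], List.forall_mem_cons.mpr ⟨hy, hzm⟩, h₂⟩ hx hxz
      have h₅ : IsWeaklyRegular M (x :: z :: ws) := by
        refine IsLocalRing.isWeaklyRegular_of_perm_of_subset_maximalIdeal
          (IsWeaklyRegular.cons hzM (IsWeaklyRegular.cons hxz hwr)) (.swap x z ws) ?_
        exact List.forall_mem_cons.mpr ⟨hz, List.forall_mem_cons.mpr ⟨hx, hwm⟩⟩
      exact ⟨z :: ws, by simp [hwl], List.forall_mem_cons.mpr ⟨hz, hwm⟩,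
        ((isWeaklyRegular_cons_iff M x _).mp h₅).2⟩

end Depth

/-! ### Avoidance of finitely many proper submodules -/

section Avoidance

variable {R : Type*} [CommRing R] [IsLocalRing R] [Infinite (ResidueField R)]

/-- By Nakayama proper submodules stay proper in `L/𝔪L`, and a vector space over an infinite field
is not a finite union of proper subspaces. -/
lemma exists_forall_notMem_of_infinite_residueField {L : Type*} [AddCommGroup L] [Module R L]
    [Module.Finite R L] {s : Set (Submodule R L)} (hs : s.Finite) (h : ∀ V ∈ s, V ≠ ⊤) :
    ∃ x : L, ∀ V ∈ s, x ∉ V := by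
  classical
  have : Finite s := hs
  let I := maximalIdeal R
  let _ : Field (R ⧸ I) := Ideal.Quotient.field I
  have : Infinite (R ⧸ I) := ‹Infinite (ResidueField R)›
  let q : L →ₗ[R] L ⧸ (I • ⊤ : Submodule R L) := Submodule.mkQ _
  have hscal (V : Submodule R (L ⧸ (I • ⊤ : Submodule R L))) :
      ∃ W : Submodule (R ⧸ I) (L ⧸ (I • ⊤ : Submodule R L)), W.restrictScalars R = V :=
    ⟨{ V with
        smul_mem' := by
          intro c x hx
          obtain ⟨c, rfl⟩ := Ideal.Quotient.mk_surjective c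
          exact V.smul_mem c hx }, by ext; rfl⟩
  choose W hW using hscal
  have hne : ¬ ∃ V : s, W (V.1.map q) = ⊤ := by
    rintro ⟨V, hV⟩
    have h1 : V.1.map q = ⊤ := by rw [← hW (V.1.map q), hV]; rfl
    have h2 : V.1 ⊔ I • ⊤ = ⊤ := by
      have := congrArg (Submodule.comap q) h1
      simpa [q, Submodule.comap_map_eq, sup_comm] using this
    exact h V.1 V.2 (top_le_iff.mp (Submodule.le_of_le_smul_of_le_jacobson_bot
      Module.Finite.fg_top (maximalIdeal_le_jacobson _) h2.ge))
  have hcov : ¬ (⋃ V : s, (W (V.1.map q) : Set (L ⧸ (I • ⊤ : Submodule R L)))) = Set.univ :=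
    fun hc ↦ hne (Subspace.exists_eq_top_of_iUnion_eq_univ hc)
  obtain ⟨y, hy⟩ := (Set.ne_univ_iff_exists_notMem _).mp hcov
  obtain ⟨x, rfl⟩ := Submodule.mkQ_surjective _ y
  refine ⟨x, fun V hV hx ↦ hy ?_⟩
  refine Set.mem_iUnion.mpr ⟨⟨V, hV⟩, ?_⟩
  have : q x ∈ (W (V.map q)).restrictScalars R := by
    rw [hW]; exact Submodule.mem_map_of_mem hx
  exact this

end Avoidance

/-! ### Superficial elements via the Rees algebra -/

section Superficial

variable {R : Type*} [CommRing R] (I : Ideal R)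

/-- The element `a t ^ n` of the Rees algebra. -/
def reesMonomial (n : ℕ) (a : R) (ha : a ∈ I ^ n) : reesAlgebra I :=
  ⟨Polynomial.monomial n a, reesAlgebra.monomial_mem.mpr ha⟩

/-- The degree one part of the Rees algebra. -/
def reesDegreeOne : I →ₗ[R] reesAlgebra I where
  toFun a := reesMonomial I 1 a (by simp)
  map_add' a b := Subtype.ext (by simp [reesMonomial])
  map_smul' c a := Subtype.ext (by simp [reesMonomial, Polynomial.smul_monomial])

/-- The ideal of the Rees algebra generated in degree one. -/
def reesIrrelevant : Ideal (reesAlgebra I) := Ideal.span (Set.range (reesDegreeOne I))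

lemma reesMonomial_mem_irrelevant_pow (n : ℕ) (a : R) (ha : a ∈ I ^ n) :
    reesMonomial I n a ha ∈ reesIrrelevant I ^ n := by
  induction n generalizing a with
  | zero => simp
  | succ n ih =>
    have key : ∀ b ∈ I * I ^ n, ∀ hb : b ∈ I ^ (n + 1),
        reesMonomial I (n + 1) b hb ∈ reesIrrelevant I ^ (n + 1) := by
      intro b hb
      induction hb using Submodule.mul_induction_on' with
      | mem_mul_mem c hc e he =>
        intro hb
        have : reesMonomial I (n + 1) (c * e) hb =
            reesDegreeOne I ⟨c, hc⟩ * reesMonomial I n e he :=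
          Subtype.ext (by
            simp [reesMonomial, reesDegreeOne, Polynomial.monomial_mul_monomial, add_comm])
        rw [this, pow_succ']
        exact Ideal.mul_mem_mul (Ideal.subset_span ⟨_, rfl⟩) (ih e he)
      | add c hc e he h1 h2 =>
        intro hb
        rw [← pow_succ'] at hc he
        have : reesMonomial I (n + 1) (c + e) hb =
            reesMonomial I (n + 1) c hc + reesMonomial I (n + 1) e he :=
          Subtype.ext (by simp [reesMonomial])
        rw [this]
        exact add_mem (h1 hc) (h2 he)
    exact key a (by rwa [← pow_succ']) ha

lemma reesMonomial_mem_map (n : ℕ) (a : R) (ha : a ∈ I ^ n) (h : a ∈ I * I ^ n) :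
    reesMonomial I n a ha ∈ I.map (algebraMap R (reesAlgebra I)) := by
  have key : ∀ b ∈ I * I ^ n, ∀ hb : b ∈ I ^ n,
      reesMonomial I n b hb ∈ I.map (algebraMap R (reesAlgebra I)) := by
    intro b hb
    induction hb using Submodule.mul_induction_on' with
    | mem_mul_mem c hc e he =>
      intro hb
      have : reesMonomial I n (c * e) hb =
          algebraMap R (reesAlgebra I) c * reesMonomial I n e he :=
        Subtype.ext (by simp [reesMonomial, ← Polynomial.C_mul_monomial])
      rw [this]
      exact Ideal.mul_mem_right _ _ (Ideal.mem_map_of_mem _ hc)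
    | add c hc e he h1 h2 =>
      intro hb
      have hc' := (Ideal.mul_le_right : I * I ^ n ≤ I ^ n) hc
      have he' := (Ideal.mul_le_right : I * I ^ n ≤ I ^ n) he
      have : reesMonomial I n (c + e) hb = reesMonomial I n c hc' + reesMonomial I n e he' :=
        Subtype.ext (by simp [reesMonomial])
      rw [this]
      exact add_mem (h1 hc') (h2 he')
  exact key a h ha

lemma coeff_mem_of_mem_map_reesAlgebra {f : reesAlgebra I}
    (hf : f ∈ I.map (algebraMap R (reesAlgebra I))) (n : ℕ) : f.1.coeff n ∈ I * I ^ n := by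
  rw [Ideal.map] at hf
  induction hf using Submodule.span_induction generalizing n with
  | mem g hg =>
    obtain ⟨a, ha, rfl⟩ := hg
    change (Polynomial.C a).coeff n ∈ _
    rw [Polynomial.coeff_C]
    split_ifs with h
    · subst h; simpa using ha
    · simp
  | zero => simp
  | add g h _ _ hg hh => simpa using add_mem (hg n) (hh n)
  | smul t g _ hg =>
    change (t.1 * g.1).coeff n ∈ _
    rw [Polynomial.coeff_mul]
    refine sum_mem fun ij hij ↦ ?_
    have := Ideal.mul_mem_mul ((mem_reesAlgebra_iff I _).mp t.2 ij.1) (hg ij.2)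
    rwa [mul_left_comm, ← pow_add, Finset.HasAntidiagonal.mem_antidiagonal.mp hij] at this

/-- If `y` avoids the associated primes of `T/J` that do not contain `K`, then the kernel `L` of `y`
on `T/J` is killed by a power of `K`; by Artin–Rees, `L` meets `K ^ n (T/J)` trivially for large
`n`. -/
lemma exists_forall_mem_of_mul_mem {T : Type*} [CommRing T] [IsNoetherianRing T] (J K : Ideal T) :
    ∃ s : Set (Ideal T), s.Finite ∧ (∀ P ∈ s, ¬ K ≤ P) ∧ ∀ y : T, (∀ P ∈ s, y ∉ P) →
      ∃ N, ∀ n ≥ N, ∀ z ∈ K ^ n, y * z ∈ J → z ∈ J := by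
  refine ⟨{P ∈ associatedPrimes T (T ⧸ J) | ¬ K ≤ P},
    (associatedPrimes.finite T (T ⧸ J)).subset (Set.sep_subset _ _), fun P hP ↦ hP.2, ?_⟩
  intro y hy
  let L : Submodule T (T ⧸ J) := LinearMap.ker (LinearMap.lsmul T (T ⧸ J) y)
  -- A minimal prime over the annihilator of `L` is associated to `T/J` and contains `y`, so by the
  -- choice of `y` it contains `K`.
  have hrad : K ≤ (Module.annihilator T L).radical := by
    rw [← Ideal.sInf_minimalPrimes]
    refine le_sInf fun P hP ↦ ?_
    have hPL := Module.associatedPrimes.minimalPrimes_annihilator_subset_associatedPrimes T L hP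
    have hPQ := associatedPrimes.subset_of_injective L.subtype_injective hPL
    by_contra hle
    refine hy P ⟨hPQ, hle⟩ ?_
    obtain ⟨-, u, rfl⟩ := isAssociatedPrime_iff.mp hPL
    rw [Submodule.mem_colon_singleton]
    exact Subtype.ext (LinearMap.mem_ker.mp u.2)
  obtain ⟨c, hc⟩ := Ideal.exists_pow_le_of_le_radical_of_fg hrad (IsNoetherian.noetherian _)
  obtain ⟨k, hk⟩ := K.exists_pow_inf_eq_pow_smul L
  refine ⟨k + c, fun n hn z hz hyz ↦ ?_⟩
  have h1 : Ideal.Quotient.mk J z ∈ (K ^ n • ⊤ : Submodule T (T ⧸ J)) := by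
    have := Submodule.smul_mem_smul hz (Submodule.mem_top (x := (1 : T ⧸ J)))
    rwa [Algebra.smul_def, mul_one] at this
  have h2 : Ideal.Quotient.mk J z ∈ L := by
    change y • Ideal.Quotient.mk J z = 0
    rwa [Algebra.smul_def, Ideal.Quotient.algebraMap_eq, ← map_mul,
      Ideal.Quotient.eq_zero_iff_mem]
  have h3 : (K ^ n • ⊤ ⊓ L : Submodule T (T ⧸ J)) ≤ ⊥ := by
    rw [hk n (by omega)]
    refine (Submodule.smul_mono ((Ideal.pow_le_pow_right (by omega)).trans hc)
      inf_le_right).trans ?_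
    rw [Submodule.smul_le]
    intro a ha u hu
    exact congrArg Subtype.val (Module.mem_annihilator.mp ha ⟨u, hu⟩)
  exact Ideal.Quotient.eq_zero_iff_mem.mp ((Submodule.mem_bot _).mp (h3 ⟨h1, h2⟩))

/-- The previous lemma is applied to the Rees algebra with `J` the extension of `I`, whose quotient
is the associated graded ring, and `K` the ideal generated in degree one. The sets to avoid are
traces on `I` of primes not containing `K`, hence proper. -/
lemma exists_forall_mem_pow_of_mul_mem [IsNoetherianRing R] :
    ∃ s : Set (Submodule R I), s.Finite ∧ (∀ V ∈ s, V ≠ ⊤) ∧ ∀ x : I, (∀ V ∈ s, x ∉ V) →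
      ∃ N, ∀ n ≥ N, ∀ z ∈ I ^ n, x * z ∈ I ^ (n + 2) → z ∈ I ^ (n + 1) := by
  obtain ⟨s, hs, hsI, hsx⟩ := exists_forall_mem_of_mul_mem
    (I.map (algebraMap R (reesAlgebra I))) (reesIrrelevant I)
  refine ⟨(fun P ↦ (P.restrictScalars R).comap (reesDegreeOne I)) '' s, hs.image _, ?_, ?_⟩
  · rintro _ ⟨P, hP, rfl⟩ htop
    refine hsI P hP (Ideal.span_le.mpr ?_)
    rintro _ ⟨a, rfl⟩
    have : a ∈ (P.restrictScalars R).comap (reesDegreeOne I) :=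
      (Submodule.eq_top_iff'.mp htop) a
    exact this
  · intro x hx
    obtain ⟨N, hN⟩ := hsx (reesDegreeOne I x) fun P hP hxP ↦ hx _ ⟨P, hP, rfl⟩ hxP
    refine ⟨N, fun n hn z hz hxz ↦ ?_⟩
    have hxz' : (x : R) * z ∈ I ^ (n + 1) := Ideal.pow_le_pow_right (by omega) hxz
    have h := hN n hn (reesMonomial I n z hz) (reesMonomial_mem_irrelevant_pow I n z hz) (by
      have : reesDegreeOne I x * reesMonomial I n z hz =
          reesMonomial I (n + 1) (x * z) hxz' :=
        Subtype.ext (by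
          simp [reesMonomial, reesDegreeOne, Polynomial.monomial_mul_monomial, add_comm])
      rw [this]
      exact reesMonomial_mem_map I _ _ _ (by rwa [← pow_succ']))
    have := coeff_mem_of_mem_map_reesAlgebra I h n
    simpa [reesMonomial, ← pow_succ'] using this

lemma isSMulRegular_of_forall_notMem_associatedPrimes {R : Type*} [CommRing R] [IsNoetherianRing R]
    {L : Type*} [AddCommGroup L] [Module R L]
    {x : R} (h : ∀ p ∈ associatedPrimes R L, x ∉ p) : IsSMulRegular L x := by
  by_contra hc
  have : x ∈ ⋃ p ∈ associatedPrimes R L, (p : Set R) := by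
    rw [biUnion_associatedPrimes_eq_compl_regular]; exact hc
  simp only [Set.mem_iUnion] at this
  obtain ⟨p, hp, hxp⟩ := this
  exact h p hp hxp

/-- Artin–Rees for `(x)` and cancellation of `x` first place `z` in `I ^ N`; the hypothesis then
raises the exponent one step at a time. -/
lemma exists_forall_mem_pow_of_mul_mem_of_isSMulRegular [IsNoetherianRing R] {x : R}
    (hx : IsSMulRegular R x)
    (h : ∃ N, ∀ n ≥ N, ∀ z ∈ I ^ n, x * z ∈ I ^ (n + 2) → z ∈ I ^ (n + 1)) :
    ∃ N, ∀ n ≥ N, ∀ z, x * z ∈ I ^ (n + 1) → z ∈ I ^ n := by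
  obtain ⟨N, hN⟩ := h
  obtain ⟨k, hk⟩ := I.exists_pow_inf_eq_pow_smul (Ideal.span {x})
  refine ⟨N + k, fun n hn z hz ↦ ?_⟩
  have h0 : z ∈ I ^ N := by
    have h1 : x * z ∈ (I ^ (n + 1) • ⊤ ⊓ Ideal.span {x} : Ideal R) :=
      ⟨by simpa using hz, Ideal.mem_span_singleton.mpr ⟨z, rfl⟩⟩
    rw [hk _ (by omega)] at h1
    have h2 : x * z ∈ I ^ N * Ideal.span {x} :=
      Submodule.smul_mono (Ideal.pow_le_pow_right (by omega)) inf_le_right h1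
    obtain ⟨y, hy, hyz⟩ := Ideal.mem_mul_span_singleton.mp h2
    rw [mul_comm] at hyz
    rwa [← hx hyz]
  have key : ∀ j, N ≤ j → j ≤ n → z ∈ I ^ j := by
    intro j hj
    induction j, hj using Nat.le_induction with
    | base => exact fun _ ↦ h0
    | succ j hj ih =>
      exact fun hjn ↦ hN j hj z (ih (by omega)) (Ideal.pow_le_pow_right (by omega) hz)
  exact key n (by omega) le_rfl

end Superficial

lemma comap_subtype_ne_top {R : Type*} [CommRing R] [IsLocalRing R] {p : Ideal R}
    (h : ¬ maximalIdeal R ≤ p) :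
    Submodule.comap (maximalIdeal R).subtype p ≠ ⊤ := by
  rwa [ne_eq, Submodule.comap_subtype_eq_top]

section SuperficialLocal

variable {R : Type*} [CommRing R] [IsLocalRing R] [IsNoetherianRing R]

lemma exists_superficial [Infinite (ResidueField R)]
    {M N : Type*} [AddCommGroup M] [Module R M] [Module.Finite R M]
    [AddCommGroup N] [Module R N] [Module.Finite R N]
    (hR : SocleTrivial R R) (hM : SocleTrivial R M) (hN : SocleTrivial R N) :
    ∃ x ∈ maximalIdeal R, x ∉ maximalIdeal R ^ 2 ∧ IsSMulRegular R x ∧ IsSMulRegular M x ∧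
      IsSMulRegular N x ∧
      ∃ n₀, ∀ n ≥ n₀, ∀ z, x * z ∈ maximalIdeal R ^ (n + 1) → z ∈ maximalIdeal R ^ n := by
  obtain ⟨s, hs, hst, hsx⟩ := exists_forall_mem_pow_of_mul_mem (maximalIdeal R)
  let t : Set (Ideal R) := associatedPrimes R R ∪ associatedPrimes R M ∪ associatedPrimes R N
  have ht : t.Finite := ((associatedPrimes.finite R R).union (associatedPrimes.finite R M)).union
    (associatedPrimes.finite R N)
  -- Otherwise `𝔪 = 0` by Nakayama, and `1` would be a nonzero socle element.
  have hsq : ¬ maximalIdeal R ≤ maximalIdeal R ^ 2 := by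
    intro hle
    have h0 : maximalIdeal R ≤ ⊥ := by
      refine Submodule.le_of_le_smul_of_le_jacobson_bot (I := maximalIdeal R)
        (IsNoetherian.noetherian _) (maximalIdeal_le_jacobson _) ?_
      rwa [bot_sup_eq, smul_eq_mul, ← pow_two]
    exact one_ne_zero (hR 1 fun a ha ↦ by simpa using h0 ha)
  obtain ⟨x, hx⟩ := exists_forall_notMem_of_infinite_residueField
    (s := s ∪ (Submodule.comap (maximalIdeal R).subtype '' t ∪
      {Submodule.comap (maximalIdeal R).subtype (maximalIdeal R ^ 2)}))
    (hs.union ((ht.image _).union (Set.finite_singleton _))) (by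
      rintro V (hV | ⟨p, (hp | hp) | hp, rfl⟩ | rfl)
      · exact hst V hV
      · exact comap_subtype_ne_top (hR.not_le_of_mem_associatedPrimes hp)
      · exact comap_subtype_ne_top (hM.not_le_of_mem_associatedPrimes hp)
      · exact comap_subtype_ne_top (hN.not_le_of_mem_associatedPrimes hp)
      · exact comap_subtype_ne_top hsq)
  have hxR : IsSMulRegular R x.1 := isSMulRegular_of_forall_notMem_associatedPrimes fun p hp hxp ↦
    hx _ (Or.inr (Or.inl ⟨p, Or.inl (Or.inl hp), rfl⟩)) hxp
  refine ⟨x, x.2, hx _ (Or.inr (Or.inr rfl)), hxR,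
    isSMulRegular_of_forall_notMem_associatedPrimes fun p hp hxp ↦
      hx _ (Or.inr (Or.inl ⟨p, Or.inl (Or.inr hp), rfl⟩)) hxp,
    isSMulRegular_of_forall_notMem_associatedPrimes fun p hp hxp ↦
      hx _ (Or.inr (Or.inl ⟨p, Or.inr hp, rfl⟩)) hxp,
    exists_forall_mem_pow_of_mul_mem_of_isSMulRegular _ hxR
      (hsx x fun V hV ↦ hx V (Or.inl hV))⟩

end SuperficialLocal

/-! ### The backward difference of a polynomial -/

section Polynomial

open Polynomial

lemma natDegree_leadingCoeff_of_sub_comp {P : ℚ[X]} {d : ℕ}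
    (h0 : P - P.comp (X - 1) ≠ 0) (hd : (P - P.comp (X - 1)).natDegree = d) :
    P.natDegree = d + 1 ∧ (P - P.comp (X - 1)).leadingCoeff = (d + 1) * P.leadingCoeff := by
  have hcomp : P.comp (X - 1) = taylor (-1) P := by
    rw [taylor_apply]; simp [sub_eq_add_neg]
  rw [hcomp] at h0 hd ⊢
  obtain ⟨n, hn⟩ : ∃ n, P.natDegree = n + 1 := by
    refine Nat.exists_eq_succ_of_ne_zero fun h ↦ h0 ?_
    rw [eq_C_of_natDegree_eq_zero h]
    simp
  have hP : P ≠ 0 := by rintro rfl; simp at hn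
  have hcoeff : (P - taylor (-1) P).coeff n = (n + 1) * P.leadingCoeff := by
    have hdeg : (hasseDeriv n P).natDegree ≤ 1 := by
      refine (natDegree_hasseDeriv_le P n).trans (by omega)
    rw [coeff_sub, taylor_coeff, eval_eq_sum_range' (n := 2) (by omega)]
    simp only [Finset.sum_range_succ, Finset.sum_range_zero, hasseDeriv_coeff, leadingCoeff, hn]
    simp [add_comm 1 n]
  have hle : (P - taylor (-1) P).natDegree ≤ n := by
    rw [natDegree_le_iff_coeff_eq_zero]
    intro k hk
    rcases Nat.lt_or_ge (n + 1) k with h | h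
    · rw [coeff_sub, coeff_eq_zero_of_natDegree_lt (by omega),
        coeff_eq_zero_of_natDegree_lt (by rw [natDegree_taylor]; omega), sub_zero]
    · obtain rfl : k = P.natDegree := by omega
      rw [coeff_sub, coeff_taylor_natDegree]
      simp
  have hne : (P - taylor (-1) P).coeff n ≠ 0 := by
    rw [hcoeff]
    have := leadingCoeff_ne_zero.mpr hP
    positivity
  have hdn : (P - taylor (-1) P).natDegree = n := natDegree_eq_of_le_of_coeff_ne_zero hle hne
  obtain rfl : n = d := by rw [← hdn, hd]
  exact ⟨hn, by rw [leadingCoeff, hdn, hcoeff]⟩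

end Polynomial

/-! ### Lengths and depth in quotient rings -/

section Quotient

variable {R : Type*} [CommRing R] [IsLocalRing R]

lemma isLocalRing_quotient_span_singleton {x : R} (hx : x ∈ maximalIdeal R) :
    IsLocalRing (R ⧸ Ideal.span {x}) :=
  have : Nontrivial (R ⧸ Ideal.span {x}) := Ideal.Quotient.nontrivial_iff.mpr fun h ↦
    (mem_maximalIdeal x).mp hx (Ideal.span_singleton_eq_top.mp h)
  .of_surjective' (Ideal.Quotient.mk _) Ideal.Quotient.mk_surjective

lemma map_mk_maximalIdeal (I : Ideal R) [IsLocalRing (R ⧸ I)] :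
    (maximalIdeal R).map (Ideal.Quotient.mk I) = maximalIdeal (R ⧸ I) := by
  have := IsLocalHom.of_surjective (Ideal.Quotient.mk I) Ideal.Quotient.mk_surjective
  have hI : I ≠ ⊤ := Ideal.Quotient.nontrivial_iff.mp inferInstance
  ext x
  obtain ⟨x, rfl⟩ := Ideal.Quotient.mk_surjective x
  simp [sup_eq_left.mpr (le_maximalIdeal hI)]

lemma infinite_residueField_quotient [Infinite (ResidueField R)] (I : Ideal R)
    [IsLocalRing (R ⧸ I)] : Infinite (ResidueField (R ⧸ I)) :=
  have := IsLocalHom.of_surjective (Ideal.Quotient.mk I) Ideal.Quotient.mk_surjective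
  .of_injective (ResidueField.map (Ideal.Quotient.mk I)) (RingHom.injective _)

lemma length_ne_top_of_pow_le [IsNoetherianRing R] {J : Ideal R} {n : ℕ}
    (h : maximalIdeal R ^ n ≤ J) : Module.length R (R ⧸ J) ≠ ⊤ := by
  rw [Module.length_eq_of_surjective (S := R) (R := R ⧸ J) Ideal.Quotient.mk_surjective]
  rcases subsingleton_or_nontrivial (R ⧸ J) with hJ | hJ
  · simp
  have : IsLocalRing (R ⧸ J) :=
    .of_surjective' (Ideal.Quotient.mk J) Ideal.Quotient.mk_surjective
  have : IsArtinianRing (R ⧸ J) := by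
    rw [isArtinianRing_iff_isNilpotent_maximalIdeal]
    refine ⟨n, ?_⟩
    rw [← map_mk_maximalIdeal, ← Ideal.map_pow, Ideal.zero_eq_bot, Ideal.map_eq_bot_iff_le_ker,
      Ideal.mk_ker]
    exact h
  exact Module.length_ne_top

lemma length_quotient_map_mk {R : Type*} [CommRing R] (I J : Ideal R) :
    Module.length (R ⧸ I) ((R ⧸ I) ⧸ J.map (Ideal.Quotient.mk I)) =
      Module.length R (R ⧸ J ⊔ I) := by
  rw [← Module.length_eq_of_surjective (S := R) (R := R ⧸ I) Ideal.Quotient.mk_surjective]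
  let f : R →ₗ[R] (R ⧸ I) ⧸ J.map (Ideal.Quotient.mk I) := Algebra.linearMap R _
  have hf : Function.Surjective f :=
    (Ideal.Quotient.mk_surjective (I := J.map (Ideal.Quotient.mk I))).comp
      Ideal.Quotient.mk_surjective
  have hk : LinearMap.ker f = J ⊔ I := by
    have h1 := Ideal.comap_map_of_surjective (Ideal.Quotient.mk I) Ideal.Quotient.mk_surjective J
    have h2 : Ideal.comap (Ideal.Quotient.mk I) ⊥ = I := by
      rw [← RingHom.ker_eq_comap_bot, Ideal.mk_ker]
    rw [h2] at h1
    rw [← h1]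
    ext r
    change Ideal.Quotient.mk _ (Ideal.Quotient.mk I r) = 0 ↔ _
    rw [Ideal.Quotient.eq_zero_iff_mem, Ideal.mem_comap]
  exact ((LinearMap.quotKerEquivOfSurjective f hf).symm.trans
    (Submodule.quotEquivOfEq _ _ hk)).length_eq

/-- The hypothesis says `I = (J : x)`, so multiplication by `x` gives `0 → R/I → R/J → R/(J + (x)) →
0`. -/
lemma length_quotient_eq_add {R : Type*} [CommRing R] {I J : Ideal R} {x : R}
    (h : ∀ z, x * z ∈ J ↔ z ∈ I) :
    Module.length R (R ⧸ J) = Module.length R (R ⧸ I) +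
      Module.length R (R ⧸ J ⊔ Ideal.span {x}) := by
  have hle : I ≤ Submodule.comap (LinearMap.lsmul R R x) J := fun z hz ↦ (h z).mpr hz
  refine Module.length_eq_add_of_exact (Submodule.mapQ I J (LinearMap.lsmul R R x) hle)
    (Submodule.factor le_sup_left) ?_ (Submodule.factor_surjective _) ?_
  · rw [← LinearMap.ker_eq_bot, LinearMap.ker_eq_bot']
    intro z hz
    obtain ⟨z, rfl⟩ := Submodule.mkQ_surjective _ z
    rw [Submodule.mkQ_apply, Submodule.mapQ_apply, Submodule.Quotient.mk_eq_zero] at hz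
    exact (Submodule.Quotient.mk_eq_zero _).mpr ((h z).mp hz)
  · intro z
    obtain ⟨z, rfl⟩ := Submodule.mkQ_surjective _ z
    rw [Submodule.mkQ_apply]
    change Submodule.Quotient.mk z = 0 ↔ _
    rw [Submodule.Quotient.mk_eq_zero]
    constructor
    · intro hz
      obtain ⟨a, ha, b, hb, rfl⟩ := Submodule.mem_sup.mp hz
      obtain ⟨c, rfl⟩ := Ideal.mem_span_singleton.mp hb
      refine ⟨Submodule.Quotient.mk c, ?_⟩
      rw [Submodule.mapQ_apply, Submodule.Quotient.eq]
      simpa using ha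
    · rintro ⟨c, hc⟩
      obtain ⟨c, rfl⟩ := Submodule.mkQ_surjective _ c
      rw [Submodule.mkQ_apply, Submodule.mapQ_apply, Submodule.Quotient.eq] at hc
      have h1 : x * c ∈ J ⊔ Ideal.span {x} :=
        Ideal.mem_sup_right (Ideal.mem_span_singleton.mpr ⟨c, rfl⟩)
      have h2 := sub_mem h1 (Ideal.mem_sup_left (T := Ideal.span {x}) hc)
      simpa using h2

lemma HasDepth.quotient {n : ℕ} {I : Ideal R} [IsLocalRing (R ⧸ I)]
    {M : Type*} [AddCommGroup M] [Module R M] [Module (R ⧸ I) M] [IsScalarTower R (R ⧸ I) M]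
    (h : HasDepth R n M) : HasDepth (R ⧸ I) n M := by
  obtain ⟨rs, hl, hm, hr⟩ := h
  refine ⟨rs.map (algebraMap R (R ⧸ I)), by simpa, ?_,
    (isWeaklyRegular_map_algebraMap_iff (R ⧸ I) M rs).mpr hr⟩
  intro r hr
  obtain ⟨r, hr', rfl⟩ := List.mem_map.mp hr
  rw [← map_mk_maximalIdeal]
  exact Ideal.mem_map_of_mem _ (hm r hr')

open Pointwise in
/-- The two ways of writing the quotient of a ring by a principal ideal. -/
def quotSMulTopSelfEquiv {R : Type*} [CommRing R] (x : R) :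
    QuotSMulTop x R ≃ₗ[R] R ⧸ Ideal.span {x} :=
  Submodule.quotEquivOfEq _ _ (by simp [← Submodule.ideal_span_singleton_smul])

lemma HasDepth.congr {n : ℕ} {M N : Type*} [AddCommGroup M] [Module R M] [AddCommGroup N]
    [Module R N] (e : M ≃ₗ[R] N) (h : HasDepth R n M) : HasDepth R n N := by
  obtain ⟨rs, hl, hm, hr⟩ := h
  exact ⟨rs, hl, hm, (e.isWeaklyRegular_congr rs).mp hr⟩

end Quotient

/-! ### Multiplicity as the length modulo a superficial sequence -/

section HilbertSamuel

variable {R : Type u} [CommRing R] [IsLocalRing R] [IsNoetherianRing R]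

open Polynomial Filter

/-- For a superficial `x` and large `n`, `(𝔪 ^ (n + 1) : x) = 𝔪 ^ n`, so the lengths for `R/(x)` are
differences of consecutive lengths for `R`. -/
lemma IsHilbertSamuelPolynomial.quotient {P : ℚ[X]} (hP : IsHilbertSamuelPolynomial R P)
    {x : R} (hx : x ∈ maximalIdeal R) [IsLocalRing (R ⧸ Ideal.span {x})]
    (h : ∃ n₀, ∀ n ≥ n₀, ∀ z, x * z ∈ maximalIdeal R ^ (n + 1) → z ∈ maximalIdeal R ^ n) :
    IsHilbertSamuelPolynomial (R ⧸ Ideal.span {x}) (P - P.comp (X - 1)) := by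
  obtain ⟨n₀, hn₀⟩ := h
  obtain ⟨n₁, hn₁⟩ := eventually_atTop.mp hP
  refine eventually_atTop.mpr ⟨n₀ + n₁ + 1, fun n hn ↦ ?_⟩
  obtain ⟨n, rfl⟩ : ∃ k, n = k + 1 := ⟨n - 1, by omega⟩
  rw [← map_mk_maximalIdeal, ← Ideal.map_pow, length_quotient_map_mk]
  have hadd := length_quotient_eq_add (I := maximalIdeal R ^ (n + 1))
    (J := maximalIdeal R ^ (n + 1 + 1)) (x := x) fun z ↦
      ⟨hn₀ (n + 1) (by omega) z, fun hz ↦ by rw [pow_succ']; exact Ideal.mul_mem_mul hx hz⟩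
  have hadd' := congrArg ENat.toNat hadd
  rw [ENat.toNat_add (length_ne_top_of_pow_le le_rfl) (length_ne_top_of_pow_le le_sup_left)]
    at hadd'
  have e1 := hn₁ (n + 1) (by omega)
  have e2 := hn₁ n (by omega)
  rw [hadd', Nat.cast_add, e2] at e1
  rw [eval_sub, eval_comp]
  simp only [eval_sub, eval_X, eval_one]
  rw [← e1]
  push_cast
  simp

lemma IsHilbertSamuelPolynomial.of_ringKrullDim_eq_zero {P : ℚ[X]}
    (hP : IsHilbertSamuelPolynomial R P) (hd : ringKrullDim R = 0) :
    ∃ e : ℕ, Module.length R R = e ∧ P = C (e : ℚ) := by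
  have : IsArtinianRing R := by
    rw [isArtinianRing_iff_krullDimLE_zero, Ring.KrullDimLE, Order.krullDimLE_iff, ← ringKrullDim,
      hd]
    rfl
  obtain ⟨k, hk⟩ := (isArtinianRing_iff_isNilpotent_maximalIdeal R).mp this
  refine ⟨(Module.length R R).toNat, (ENat.natCast_toNat Module.length_ne_top).symm, ?_⟩
  obtain ⟨n₁, hn₁⟩ := eventually_atTop.mp hP
  refine eq_of_infinite_eval_eq _ _ (Set.Infinite.mono
    (s := (fun n : ℕ ↦ (n : ℚ)) '' Set.Ici (n₁ + k)) ?_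
    ((Set.Ici_infinite _).image Nat.cast_injective.injOn))
  rintro _ ⟨n, hn, rfl⟩
  have hn' : n₁ + k ≤ n := hn
  have h0 : maximalIdeal R ^ (n + 1) = ⊥ := by
    refine le_bot_iff.mp ((Ideal.pow_le_pow_right (by omega : k ≤ n + 1)).trans ?_)
    rw [hk]; rfl
  have := hn₁ n (by omega)
  simp only [Set.mem_ofPred_eq, eval_C]
  rw [← this, h0, (Submodule.quotEquivOfEqBot _ rfl).length_eq]

/-- A sequence in the maximal ideal whose members are independent modulo the square of the
maximal ideal. -/
def IsIndependentModSq (R : Type*) [CommRing R] [IsLocalRing R] (xs : List R) : Prop :=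
  ∀ (i : ℕ) (h : i < xs.length), xs[i] ∉ Ideal.ofList (xs.take i) ⊔ maximalIdeal R ^ 2

lemma IsIndependentModSq.cons {R : Type*} [CommRing R] [IsLocalRing R] {x : R}
    [IsLocalRing (R ⧸ Ideal.span {x})] (hx : x ∉ maximalIdeal R ^ 2) {xs : List R}
    (h : IsIndependentModSq (R ⧸ Ideal.span {x}) (xs.map (Ideal.Quotient.mk _))) :
    IsIndependentModSq R (x :: xs) := by
  rintro (_ | i) hi
  · simpa using hx
  · intro hmem
    refine h i (by simpa using hi) ?_
    have := Ideal.mem_map_of_mem (Ideal.Quotient.mk (Ideal.span {x})) hmem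
    rw [Ideal.map_sup, Ideal.map_pow, map_mk_maximalIdeal, List.take_succ_cons,
      Ideal.ofList_cons, Ideal.map_sup, Ideal.map_quotient_self, bot_sup_eq,
      Ideal.map_ofList, List.map_take] at this
    simpa using this

/-- Each superficial element lowers the dimension by one and replaces `P` by its backward
difference, which divides out one factor of `d!` in the normalization. The degree of `P` is carried
along to identify that factor. -/
theorem exists_isWeaklyRegular_length_eq_multiplicity (d : ℕ) :
    ∀ (R : Type u) [CommRing R] [IsLocalRing R] [IsNoetherianRing R] [Infinite (ResidueField R)]
      (M N : Type u) [AddCommGroup M] [Module R M] [Module.Finite R M]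
      [AddCommGroup N] [Module R N] [Module.Finite R N] (P : ℚ[X]),
      ringKrullDim R = d → HasDepth R d R → HasDepth R d M → HasDepth R d N →
      IsHilbertSamuelPolynomial R P →
      ∃ xs : List R, xs.length = d ∧ (∀ r ∈ xs, r ∈ maximalIdeal R) ∧ IsWeaklyRegular R xs ∧
        IsWeaklyRegular M xs ∧ IsWeaklyRegular N xs ∧ IsIndependentModSq R xs ∧
        P.natDegree = d ∧ ∃ e : ℕ, Module.length R (R ⧸ Ideal.ofList xs) = e ∧
          (d.factorial : ℚ) * P.leadingCoeff = e := by
  induction d with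
  | zero =>
    intro R _ _ _ _ M N _ _ _ _ _ _ P hd _ _ _ hP
    obtain ⟨e, he, rfl⟩ := hP.of_ringKrullDim_eq_zero (by simpa using hd)
    refine ⟨[], rfl, by simp, .nil _ _, .nil _ _, .nil _ _, fun i hi ↦ by simp at hi,
      natDegree_C _, e, ?_, by rw [leadingCoeff_C]; simp⟩
    rw [Ideal.ofList_nil, (Submodule.quotEquivOfEqBot _ rfl).length_eq, he]
  | succ d ih =>
    intro R _ _ _ _ M N _ _ _ _ _ _ P hd hR hM hN hP
    obtain ⟨x, hx, hx2, hxR, hxM, hxN, hsup⟩ :=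
      exists_superficial hR.socleTrivial hM.socleTrivial hN.socleTrivial
    have := isLocalRing_quotient_span_singleton hx
    have := infinite_residueField_quotient (Ideal.span {x})
    have : Module.Finite (R ⧸ Ideal.span {x}) (QuotSMulTop x M) :=
      .of_restrictScalars_finite R _ _
    have : Module.Finite (R ⧸ Ideal.span {x}) (QuotSMulTop x N) :=
      .of_restrictScalars_finite R _ _
    have hd' : ringKrullDim (R ⧸ Ideal.span {x}) = d := by
      have h1 := ringKrullDim_quotient_span_singleton_succ_eq_ringKrullDim hxR hx
      rw [hd] at h1
      push_cast at h1
      exact ENat.WithBot.add_one_cancel.mp h1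
    obtain ⟨ys, hyl, hym, hyR, hyM, hyN, hyi, hdeg, e, he, hlc⟩ :=
      ih (R ⧸ Ideal.span {x}) (QuotSMulTop x M) (QuotSMulTop x N) (P - P.comp (X - 1)) hd'
        ((hR.quotSMulTop hx hxR).congr (quotSMulTopSelfEquiv x)).quotient
        (hM.quotSMulTop hx hxM).quotient (hN.quotSMulTop hx hxN).quotient (hP.quotient hx hsup)
    obtain ⟨xs, rfl⟩ : ∃ xs : List R, xs.map (Ideal.Quotient.mk (Ideal.span {x})) = ys :=
      ⟨ys.map (Function.surjInv Ideal.Quotient.mk_surjective), by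
        simp [Function.comp_def, Function.surjInv_eq]⟩
    -- A zero difference would give `e = 0`, but `e` is the length of a nonzero ring.
    have hne : P - P.comp (X - 1) ≠ 0 := by
      intro h0
      have : Nontrivial ((R ⧸ Ideal.span {x}) ⧸
          Ideal.ofList (xs.map (Ideal.Quotient.mk (Ideal.span {x})))) :=
        Ideal.Quotient.nontrivial_iff.mpr fun h ↦
          Ideal.IsPrime.ne_top' (I := maximalIdeal (R ⧸ Ideal.span {x}))
            (top_le_iff.mp (h ▸ Ideal.span_le.mpr hym))
      have h1 := Module.length_pos (R := R ⧸ Ideal.span {x})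
        (M := (R ⧸ Ideal.span {x}) ⧸ Ideal.ofList (xs.map (Ideal.Quotient.mk (Ideal.span {x}))))
      rw [he] at h1
      rw [h0] at hlc
      simp only [leadingCoeff_zero, mul_zero] at hlc
      have : e = 0 := by exact_mod_cast hlc.symm
      simp [this] at h1
    obtain ⟨hdegP, hlcP⟩ := natDegree_leadingCoeff_of_sub_comp hne hdeg
    refine ⟨x :: xs, by simpa using hyl, ?_, ?_, hyM.cons' hxM, hyN.cons' hxN, hyi.cons hx2,
      hdegP, e, ?_, ?_⟩
    · refine List.forall_mem_cons.mpr ⟨hx, fun r hr ↦ ?_⟩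
      have := hym _ (List.mem_map_of_mem hr)
      rw [← map_mk_maximalIdeal, Ideal.mem_map_iff_of_surjective _ Ideal.Quotient.mk_surjective]
        at this
      obtain ⟨s, hs, hsr⟩ := this
      have h1 := (Ideal.span_singleton_le_iff_mem _).mpr hx (Ideal.Quotient.eq.mp hsr)
      simpa using sub_mem hs h1
    · refine .cons hxR (((quotSMulTopSelfEquiv x).isWeaklyRegular_congr xs).mpr ?_)
      exact (isWeaklyRegular_map_algebraMap_iff (R ⧸ Ideal.span {x}) _ xs).mp hyR
    · rw [← he, ← Ideal.map_ofList, length_quotient_map_mk, Ideal.ofList_cons, sup_comm]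
    · rw [← hlc, hlcP, Nat.factorial_succ]
      push_cast
      ring

end HilbertSamuel

/-! ### Length under flat base change -/

section LengthBaseChange

variable {R S : Type*} [CommRing R] [IsLocalRing R] [CommRing S] [IsLocalRing S] [Algebra R S]
  [Module.Flat R S]

/-- Induction along a composition series: `S ⊗ k = S/𝔪S` is again simple. -/
lemma length_tensorProduct (hm : (maximalIdeal R).map (algebraMap R S) = maximalIdeal S)
    {X : Type*} [AddCommGroup X] [Module R X] (h : IsFiniteLength R X) :
    Module.length S (S ⊗[R] X) = Module.length R X := by
  induction h with
  | of_subsingleton => simp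
  | @of_simple_quotient X _ _ Y hXY hY ih =>
    have h1 := Module.length_eq_add_of_exact Y.subtype Y.mkQ Y.subtype_injective
      Y.mkQ_surjective (LinearMap.exact_subtype_mkQ Y)
    have h2 := Module.length_eq_add_of_exact (Y.subtype.baseChange S) (Y.mkQ.baseChange S)
      (Module.Flat.lTensor_preserves_injective_linearMap (M := S) _ Y.subtype_injective)
      (LinearMap.lTensor_surjective S Y.mkQ_surjective)
      (Module.Flat.lTensor_exact S (LinearMap.exact_subtype_mkQ Y))
    have h3 : Module.length S (S ⊗[R] (X ⧸ Y)) = 1 := by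
      obtain ⟨I, hI, ⟨e⟩⟩ := isSimpleModule_iff_quot_maximal.mp hXY
      obtain rfl : I = maximalIdeal R := eq_maximalIdeal hI
      rw [(e.baseChange R S _ _).length_eq,
        ← (Algebra.TensorProduct.quotIdealMapEquivTensorQuot S
          (maximalIdeal R)).toLinearEquiv.length_eq, Module.length_eq_one_iff, hm]
      exact isSimpleModule_iff_quot_maximal.mpr ⟨_, maximalIdeal.isMaximal S, ⟨.refl _ _⟩⟩
    rw [h2, h1, ih, h3, Module.length_eq_one_iff.mpr hXY]

lemma length_quotient_maximalIdeal_pow [IsNoetherianRing R]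
    (hm : (maximalIdeal R).map (algebraMap R S) = maximalIdeal S) (n : ℕ) :
    Module.length S (S ⧸ maximalIdeal S ^ n) = Module.length R (R ⧸ maximalIdeal R ^ n) := by
  rw [← length_tensorProduct hm
    (Module.length_ne_top_iff.mp (length_ne_top_of_pow_le le_rfl)),
    ← (Algebra.TensorProduct.quotIdealMapEquivTensorQuot S
          (maximalIdeal R ^ n)).toLinearEquiv.length_eq, Ideal.map_pow, hm]

end LengthBaseChange

/-! ### Embedding dimension and lengths modulo `𝔪 ^ 2` -/

section EmbeddingDimension

variable {R : Type*} [CommRing R] [IsLocalRing R]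

lemma eq_of_le_of_length_quotient_le {R : Type*} [CommRing R] {I J : Ideal R} (hIJ : I ≤ J)
    (h : Module.length R (R ⧸ I) ≤ Module.length R (R ⧸ J))
    (hJ : Module.length R (R ⧸ J) ≠ ⊤) : I = J := by
  let f : (R ⧸ I) →ₗ[R] (R ⧸ J) := Submodule.factor hIJ
  have hadd := Module.length_eq_add_of_exact (LinearMap.ker f).subtype f
    (Submodule.subtype_injective _) (Submodule.factor_surjective hIJ)
    (LinearMap.exact_subtype_ker_map f)
  have h0 : Module.length R (LinearMap.ker f) = 0 := by
    rw [hadd] at h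
    by_contra hne
    have h1 : 1 ≤ Module.length R (LinearMap.ker f) := Order.one_le_iff_ne_zero.mpr hne
    have h2 : Module.length R (R ⧸ J) + 1 ≤ Module.length R (R ⧸ J) := by
      rw [add_comm]
      exact (add_le_add_left h1 _).trans h
    exact absurd ((ENat.add_one_le_iff hJ).mp h2) (lt_irrefl _)
  have h1 : Subsingleton (LinearMap.ker f) := Module.length_eq_zero_iff.mp h0
  refine le_antisymm hIJ fun a ha ↦ ?_
  have h2 : f (Submodule.Quotient.mk a) = 0 := (Submodule.Quotient.mk_eq_zero J).mpr ha
  have h3 : (⟨Submodule.Quotient.mk a, h2⟩ : LinearMap.ker f) = 0 := Subsingleton.elim _ _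
  exact (Submodule.Quotient.mk_eq_zero I).mp (congrArg Subtype.val h3)

lemma length_quotient_maximalIdeal_sq [IsNoetherianRing R] :
    Module.length R (R ⧸ maximalIdeal R ^ 2) = (maximalIdeal R).spanFinrank + 1 := by
  rw [spanFinrank_maximalIdeal_eq_finrank_cotangentSpace]
  have h1 : Module.length R (CotangentSpace R) =
      Module.finrank (ResidueField R) (CotangentSpace R) := by
    rw [Module.length_eq_of_surjective (S := R) (R := ResidueField R) Ideal.Quotient.mk_surjective,
      Module.length_of_free_of_finite]
    simp
  have h2 : Module.length R (R ⧸ maximalIdeal R) = 1 := by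
    rw [Module.length_eq_one_iff]
    exact isSimpleModule_iff_quot_maximal.mpr ⟨_, maximalIdeal.isMaximal R, ⟨.refl _ _⟩⟩
  rw [← h1, ← h2]
  have hle : maximalIdeal R ^ 2 ≤ maximalIdeal R := Ideal.pow_le_self two_ne_zero
  refine Module.length_eq_add_of_exact (M := R ⧸ maximalIdeal R ^ 2)
    ((maximalIdeal R).cotangentToQuotientSquare)
    (Submodule.factor hle) (Ideal.cotangentToQuotientSquare_injective _)
    (Submodule.factor_surjective hle) ?_
  rw [LinearMap.exact_iff, Ideal.range_cotangentToQuotientSquare]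
  ext z
  obtain ⟨z, rfl⟩ := Submodule.mkQ_surjective _ z
  change Submodule.Quotient.mk z = 0 ↔ Ideal.Quotient.mk (maximalIdeal R ^ 2) z ∈ _
  rw [Submodule.Quotient.mk_eq_zero, Submodule.restrictScalars_mem, Ideal.cotangentIdeal]
  constructor
  · exact fun hz ↦ ⟨z, hz, rfl⟩
  · rintro ⟨y, hy, hyz⟩
    have := hle (Ideal.Quotient.eq.mp hyz)
    simpa using sub_mem hy this

/-- The submodule of `R/J` generated by `x` is `R/(J : x)`, a quotient of `k` because `𝔪x ⊆ 𝔪 ^ 2 ⊆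
J`. -/
lemma length_quotient_le_add_length {x : R} (hx : x ∈ maximalIdeal R) {J : Ideal R}
    (hJ : maximalIdeal R ^ 2 ≤ J) :
    Module.length R (R ⧸ J) ≤ Module.length R (R ⧸ J ⊔ Ideal.span {x}) + 1 := by
  let I : Ideal R := J.colon {x}
  have h := length_quotient_eq_add (I := J.colon {x}) (J := J) (x := x) fun z ↦ by
    rw [Submodule.mem_colon_singleton, smul_eq_mul, mul_comm]
  have hI : Module.length R (R ⧸ J.colon {x}) ≤ 1 := by
    have : maximalIdeal R ≤ J.colon {x} := fun a ha ↦ by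
      rw [Submodule.mem_colon_singleton, smul_eq_mul]
      exact hJ (by rw [pow_two]; exact Ideal.mul_mem_mul ha hx)
    have h1 : Module.length R (R ⧸ maximalIdeal R) = 1 := by
      rw [Module.length_eq_one_iff]
      exact isSimpleModule_iff_quot_maximal.mpr ⟨_, maximalIdeal.isMaximal R, ⟨.refl _ _⟩⟩
    rw [← h1]
    exact Module.length_le_of_surjective (Submodule.factor this) (Submodule.factor_surjective this)
  rw [h, add_comm]
  gcongr

lemma length_quotient_sq_le {xs : List R} (h : ∀ r ∈ xs, r ∈ maximalIdeal R) :
    Module.length R (R ⧸ maximalIdeal R ^ 2) ≤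
      Module.length R (R ⧸ Ideal.ofList xs ⊔ maximalIdeal R ^ 2) + xs.length := by
  induction xs with
  | nil => rw [Ideal.ofList_nil, bot_sup_eq]; simp
  | cons x xs ih =>
    refine (ih fun r hr ↦ h r (by simp [hr])).trans ?_
    have := length_quotient_le_add_length (h x (by simp))
      (le_sup_right : _ ≤ Ideal.ofList xs ⊔ maximalIdeal R ^ 2)
    rw [sup_comm (Ideal.ofList xs ⊔ _), ← sup_assoc, ← Ideal.ofList_cons] at this
    grw [this]
    rw [add_assoc, List.length_cons, add_comm 1]
    simp

end EmbeddingDimension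

/-! ### The extension `R(X)` and the generic regular sequence -/

section GenericExtension

variable (R : Type u) [CommRing R] [IsLocalRing R]

open Polynomial

/-- The localization `R(X)` of `R[X]` at the extension of the maximal ideal. -/
abbrev GenericExtension : Type u :=
  Localization.AtPrime ((maximalIdeal R).map (C : R →+* R[X]))

instance : Module.Flat R (GenericExtension R) :=
  .trans R R[X] _

lemma map_maximalIdeal_genericExtension :
    (maximalIdeal R).map (algebraMap R (GenericExtension R)) =
      maximalIdeal (GenericExtension R) := by
  rw [IsScalarTower.algebraMap_eq R R[X] (GenericExtension R), ← Ideal.map_map,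
    Polynomial.algebraMap_eq, Localization.AtPrime.map_eq_maximalIdeal]

lemma ringKrullDim_genericExtension [IsNoetherianRing R] :
    ringKrullDim (GenericExtension R) = ringKrullDim R := by
  rw [IsLocalization.AtPrime.ringKrullDim_eq_height ((maximalIdeal R).map (C : R →+* R[X])),
    height_map_C, maximalIdeal_height_eq_ringKrullDim]

instance : Infinite (ResidueField (GenericExtension R)) := by
  -- The residues of the powers of `X` are pairwise distinct.
  refine .of_injective (fun n : ℕ ↦
    residue (GenericExtension R) (algebraMap R[X] (GenericExtension R) (X ^ n))) fun i j hij ↦ ?_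
  by_contra hne
  simp only at hij
  rw [← sub_eq_zero, ← map_sub, ← map_sub, residue_eq_zero_iff,
    IsLocalization.AtPrime.to_map_mem_maximal_iff (GenericExtension R)
      ((maximalIdeal R).map (C : R →+* R[X])), Ideal.mem_map_C_iff] at hij
  have := hij i
  simp [coeff_X_pow, hne] at this

instance : IsLocalHom (algebraMap R (GenericExtension R)) := by
  refine ((local_hom_TFAE (algebraMap R (GenericExtension R))).out 0 2).mpr ?_
  rw [map_maximalIdeal_genericExtension]

instance : Module.FaithfullyFlat R (GenericExtension R) :=
  .of_flat_of_isLocalHom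

lemma HasDepth.tensorProduct {R S : Type*} [CommRing R] [IsLocalRing R] [CommRing S]
    [IsLocalRing S] [Algebra R S] [Module.Flat R S] [IsLocalHom (algebraMap R S)]
    {n : ℕ} {M : Type*} [AddCommGroup M] [Module R M] (h : HasDepth R n M) :
    HasDepth S n (S ⊗[R] M) := by
  obtain ⟨rs, hl, hm, hr⟩ := h
  refine ⟨rs.map (algebraMap R S), by simpa, fun r hr' ↦ ?_,
    hr.of_flat_of_isBaseChange (TensorProduct.isBaseChange R M S)⟩
  obtain ⟨a, ha, rfl⟩ := List.mem_map.mp hr'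
  exact map_maximalIdeal_le (algebraMap R S) (Ideal.mem_map_of_mem _ (hm a ha))

lemma hasDepth_of_depth_eq {R : Type u} [CommRing R] [IsLocalRing R]
    {M : Type u} [AddCommGroup M] [Module R M] [Nontrivial M] {d : ℕ} (h : depth R M = d) :
    HasDepth R d M := by
  have : Nonempty {rs : List R // IsRegular M rs ∧ ∀ r ∈ rs, r ∈ maximalIdeal R} :=
    ⟨⟨[], .nil _ _, by simp⟩⟩
  obtain ⟨rs, hrs⟩ := ENat.exists_eq_iSup_of_lt_top
    (f := fun rs : {rs : List R // IsRegular M rs ∧ ∀ r ∈ rs, r ∈ maximalIdeal R} ↦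
      (rs.1.length : ℕ∞)) (by
        change depth R M < ⊤
        rw [h]; exact ENat.natCast_lt_top d)
  refine ⟨rs.1, ?_, rs.2.2, rs.2.1.toIsWeaklyRegular⟩
  have : (rs.1.length : ℕ∞) = d := hrs.trans h
  exact_mod_cast this

variable {R}

/-- Existence of the polynomial comes from the hypothesis itself: the default multiplicity `0` is
excluded since `μ - d + 1 ≥ 1`. -/
lemma exists_isHilbertSamuelPolynomial_of_hasMinimalMultiplicity [IsNoetherianRing R] {d : ℕ}
    (hd : ringKrullDim R = d) (hmin : HasMinimalMultiplicity R) :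
    ∃ P, IsHilbertSamuelPolynomial R P ∧
      (d.factorial : ℚ) * P.leadingCoeff = (maximalIdeal R).spanFinrank - d + 1 := by
  have hdim : dim R = d := by
    rw [dim, hd]; rfl
  have hle : d ≤ (maximalIdeal R).spanFinrank := by
    have := ringKrullDim_le_spanFinrank_maximalIdeal (R := R)
    rw [hd] at this
    exact_mod_cast this
  rw [HasMinimalMultiplicity, samuelMultiplicity, hdim] at hmin
  split_ifs at hmin with h
  · exact ⟨_, h.choose_spec, hmin⟩
  · have : (d : ℚ) ≤ (maximalIdeal R).spanFinrank := by exact_mod_cast hle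
    linarith

/-- A generic maximal regular sequence on a Cohen-Macaulay local ring of minimal multiplicity. -/
theorem exists_isWeaklyRegular_maximalIdeal_sq_le [IsNoetherianRing R] {d : ℕ}
    (hd : ringKrullDim R = d) (hmin : HasMinimalMultiplicity R)
    (M N : Type u) [AddCommGroup M] [Module R M] [AddCommGroup N] [Module R N]
    [Module.Finite R M] [Module.Finite R N]
    (hR : HasDepth R d R) (hM : HasDepth R d M) (hN : HasDepth R d N) :
    ∃ xs : List (GenericExtension R), xs.length = d ∧
      (∀ r ∈ xs, r ∈ maximalIdeal (GenericExtension R)) ∧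
      IsWeaklyRegular (GenericExtension R) xs ∧
      IsWeaklyRegular (GenericExtension R ⊗[R] M) xs ∧
      IsWeaklyRegular (GenericExtension R ⊗[R] N) xs ∧
      IsIndependentModSq (GenericExtension R) xs ∧
      maximalIdeal (GenericExtension R) ^ 2 ≤ Ideal.ofList xs ∧
      (IsRegularLocalRing R ↔ maximalIdeal (GenericExtension R) ≤ Ideal.ofList xs) := by
  let S := GenericExtension R
  obtain ⟨P, hP, hlc⟩ := exists_isHilbertSamuelPolynomial_of_hasMinimalMultiplicity hd hmin
  have hlen := length_quotient_maximalIdeal_pow (S := S) (map_maximalIdeal_genericExtension R)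
  have hPS : IsHilbertSamuelPolynomial S P := by
    filter_upwards [hP] with n hn
    rw [hlen, hn]
  obtain ⟨xs, hl, hm, hxS, hxM, hxN, hind, -, e, he, hlc'⟩ :=
    exists_isWeaklyRegular_length_eq_multiplicity d S (S ⊗[R] M) (S ⊗[R] N) P
      ((ringKrullDim_genericExtension R).trans hd)
      ((hR.tensorProduct (S := S)).congr (AlgebraTensorModule.rid R S S))
      hM.tensorProduct hN.tensorProduct hPS
  have heq : e + d = (maximalIdeal R).spanFinrank + 1 := by
    rw [hlc] at hlc'
    have : (e : ℚ) + d = (maximalIdeal R).spanFinrank + 1 := by linarith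
    exact_mod_cast this
  have hsq := length_quotient_sq_le hm
  rw [hlen, length_quotient_maximalIdeal_sq, hl] at hsq
  have hofList : Ideal.ofList xs ≤ maximalIdeal S := Ideal.span_le.mpr hm
  have hone : Module.length S (S ⧸ maximalIdeal S) = 1 := by
    rw [Module.length_eq_one_iff]
    exact isSimpleModule_iff_quot_maximal.mpr ⟨_, maximalIdeal.isMaximal S, ⟨.refl _ _⟩⟩
  refine ⟨xs, hl, hm, hxS, hxM, hxN, hind, ?_, fun hreg ↦ ?_, fun hle ↦ ?_⟩
  -- `length (S/((xs) + 𝔪 ^ 2)) ≥ μ + 1 - d = e = length (S/(xs))`, so adding `𝔪 ^ 2` changes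
  -- nothing.
  · have h1 : Ideal.ofList xs = Ideal.ofList xs ⊔ maximalIdeal S ^ 2 := by
      refine eq_of_le_of_length_quotient_le le_sup_left ?_ (length_ne_top_of_pow_le le_sup_right)
      rw [he]
      have h2 : ((e + d : ℕ) : ℕ∞) ≤
          Module.length S (S ⧸ Ideal.ofList xs ⊔ maximalIdeal S ^ 2) + d := by
        rw [heq]; exact_mod_cast hsq
      push_cast at h2
      exact (ENat.add_le_add_iff_right (ENat.natCast_ne_top d)).mp h2
    rw [h1]
    exact le_sup_right
  · have h1 : (maximalIdeal R).spanFinrank = d := by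
      have := (isRegularLocalRing_iff R).mp hreg
      rw [hd] at this
      exact_mod_cast this
    have h2 : e = 1 := by omega
    refine (eq_of_le_of_length_quotient_le hofList ?_ ?_).ge
    · rw [he, hone, h2]; rfl
    · rw [hone]; simp
  · refine IsRegularLocalRing.of_spanFinrank_maximalIdeal_le R ?_
    have h1 : Ideal.ofList xs ⊔ maximalIdeal S ^ 2 = maximalIdeal S :=
      le_antisymm (sup_le hofList (Ideal.pow_le_self two_ne_zero)) (hle.trans le_sup_left)
    rw [h1, hone, add_comm] at hsq
    rw [hd]
    have : (maximalIdeal R).spanFinrank ≤ d := by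
      have : ((1 + (maximalIdeal R).spanFinrank : ℕ) : ℕ∞) ≤ ((1 + d : ℕ) : ℕ∞) := by
        exact_mod_cast hsq
      have := ENat.natCast_le_natCast.mp this
      omega
    exact_mod_cast this

end GenericExtension

/-! ### Syzygies of the residue field modulo the sequence -/

section FreeModules

variable {R : Type*} [CommRing R] {G : Type*} [AddCommGroup G] [Module R G]

lemma mem_ideal_smul_top_iff_repr {ι : Type*} (b : Module.Basis ι R G) (I : Ideal R) (g : G) :
    g ∈ (I • ⊤ : Submodule R G) ↔ ∀ i, b.repr g i ∈ I := by
  constructor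
  · intro hg i
    induction hg using Submodule.smul_induction_on' with
    | smul r hr n _ => simpa using I.mul_mem_right _ hr
    | add x _ y _ hx hy => simpa using add_mem hx hy
  · intro h
    rw [← b.linearCombination_repr g, Finsupp.linearCombination_apply]
    exact sum_mem fun i _ ↦ Submodule.smul_mem_smul (h i) Submodule.mem_top

lemma mem_ideal_smul_top_of_smul_mem [Module.Free R G] {I J : Ideal R} {x : R}
    (h : ∀ s, x * s ∈ I → s ∈ J) {g : G} (hg : x • g ∈ (I • ⊤ : Submodule R G)) :
    g ∈ (J • ⊤ : Submodule R G) := by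
  let b := Module.Free.chooseBasis R G
  rw [mem_ideal_smul_top_iff_repr b] at hg ⊢
  exact fun i ↦ h _ (by simpa using hg i)

lemma map_mem_ideal_smul_top {H : Type*} [AddCommGroup H] [Module R H] (f : G →ₗ[R] H)
    {I : Ideal R} {g : G} (hg : g ∈ (I • ⊤ : Submodule R G)) :
    f g ∈ (I • ⊤ : Submodule R H) :=
  Submodule.smul_top_le_comap_smul_top I f hg

lemma map_mem_ideal_mul_smul_top {H : Type*} [AddCommGroup H] [Module R H] {f : G →ₗ[R] H}
    {I J : Ideal R} (hf : LinearMap.range f ≤ J • ⊤) {g : G}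
    (hg : g ∈ (I • ⊤ : Submodule R G)) : f g ∈ ((I * J) • ⊤ : Submodule R H) := by
  have h1 : f g ∈ Submodule.map f (I • ⊤) := Submodule.mem_map_of_mem hg
  rw [Submodule.map_smul'', Submodule.map_top] at h1
  rw [Submodule.mul_smul]
  exact Submodule.smul_mono le_rfl hf h1

end FreeModules

section Syzygies

variable {R : Type*} [CommRing R] [IsLocalRing R] {G : ℕ → Type*} [∀ n, AddCommGroup (G n)]
  [∀ n, Module R (G n)] [∀ n, Module.Free R (G n)]

/-- In a minimal free resolution of the residue field, an element of `𝔪 G` that is a cycle modulo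
a sequence is a boundary modulo that sequence, if the sequence is regular and independent modulo
the square of the maximal ideal. -/
lemma mem_range_sup_of_map_mem (d : ∀ n, G (n + 1) →ₗ[R] G n)
    (hex : ∀ n, Function.Exact (d (n + 1)) (d n))
    (h0 : maximalIdeal R • ⊤ ≤ LinearMap.range (d 0))
    (hmin : ∀ n, LinearMap.range (d n) ≤ maximalIdeal R • ⊤)
    {xs : List R} (hm : ∀ r ∈ xs, r ∈ maximalIdeal R) (hreg : IsWeaklyRegular R xs)
    (hind : IsIndependentModSq R xs) (j : ℕ) (hj : j ≤ xs.length) (n : ℕ) (f : G (n + 1))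
    (hf : f ∈ maximalIdeal R • (⊤ : Submodule R (G (n + 1))))
    (hdf : d n f ∈ Ideal.ofList (xs.take j) • (⊤ : Submodule R (G n))) :
    f ∈ LinearMap.range (d (n + 1)) ⊔ Ideal.ofList (xs.take j) • ⊤ := by
  induction j generalizing n f with
  | zero =>
    rw [List.take_zero, Ideal.ofList_nil, Submodule.bot_smul, Submodule.mem_bot] at hdf
    exact Submodule.mem_sup_left ((hex n f).mp hdf)
  | succ j ih =>
    replace hj : j < xs.length := hj
    have hJ : Ideal.ofList (xs.take (j + 1)) = Ideal.ofList (xs.take j) ⊔ Ideal.span {xs[j]} := by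
      rw [List.take_succ_eq_append_getElem hj, Ideal.ofList_append, Ideal.ofList_singleton]
    rw [hJ] at hdf ⊢
    generalize hJj : Ideal.ofList (xs.take j) = J at *
    generalize hxj : xs[j] = x at *
    have hxJ (s : R) (hs : x * s ∈ J) : s ∈ J := by
      have h1 := hreg.regular_mod_prev j hj
      rw [hJj, hxj] at h1
      refine mem_of_isSMulRegular_quotient_of_smul_mem h1 ?_ |> fun h ↦ by simpa using h
      simpa using hs
    -- If `s` were a unit, `x` would lie in `J + 𝔪 ^ 2`, against independence.
    have hxm (s : R) (hs : x * s ∈ J ⊔ maximalIdeal R ^ 2) : s ∈ maximalIdeal R := by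
      by_contra hsu
      rw [mem_maximalIdeal, mem_nonunits_iff, not_not] at hsu
      refine hind j hj ?_
      rw [hJj, hxj]
      obtain ⟨t, rfl⟩ := hsu
      simpa using Ideal.mul_mem_right (↑t⁻¹ : R) _ hs
    rw [Submodule.sup_smul, Submodule.ideal_span_singleton_smul] at hdf
    obtain ⟨p, hp, q, hq, hpq⟩ := Submodule.mem_sup.mp hdf
    obtain ⟨g, -, rfl⟩ := (Submodule.mem_smul_pointwise_iff_exists _ _ _).mp hq
    -- Here `d f = p + x g` with `p ∈ JG`, and `d f ∈ 𝔪 ^ 2 G` by minimality, so the coordinates of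
    -- `g` satisfy the condition of `hxm`.
    have hgm : g ∈ maximalIdeal R • (⊤ : Submodule R (G n)) := by
      refine mem_ideal_smul_top_of_smul_mem hxm ?_
      have h1 : d n f ∈ (maximalIdeal R ^ 2) • (⊤ : Submodule R (G n)) := by
        rw [pow_two]; exact map_mem_ideal_mul_smul_top (hmin n) hf
      rw [Submodule.sup_smul, ← add_sub_cancel_left p (x • g), hpq, ← neg_sub, neg_sub]
      exact sub_mem (Submodule.mem_sup_right h1) (Submodule.mem_sup_left hp)
    -- Applying the differential to `p + x g` and cancelling `x` modulo `J` shows that `g` is a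
    -- cycle modulo `J`, one homological degree lower.
    have hg : g ∈ LinearMap.range (d n) ⊔ J • ⊤ := by
      rcases n with _ | n
      · exact Submodule.mem_sup_left (h0 hgm)
      · refine ih hj.le n g hgm (mem_ideal_smul_top_of_smul_mem hxJ ?_)
        have h1 : d n (d (n + 1) f) = 0 := (hex n).apply_apply_eq_zero f
        rw [← hpq, map_add, map_smul] at h1
        rw [eq_neg_of_add_eq_zero_right h1]
        exact neg_mem (map_mem_ideal_smul_top _ hp)
    obtain ⟨_, ⟨h, rfl⟩, q, hqJ, rfl⟩ := Submodule.mem_sup.mp hg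
    have hxmem : x ∈ maximalIdeal R := hxj ▸ hm _ (List.getElem_mem hj)
    have hxh : x • h ∈ maximalIdeal R • (⊤ : Submodule R (G (n + 1))) :=
      Submodule.smul_mem_smul hxmem Submodule.mem_top
    -- With `g = d h + q`, the corrected element `f - x h` is a cycle modulo the shorter sequence.
    have key := ih hj.le n (f - x • h) (sub_mem hf hxh) (by
      rw [map_sub, map_smul, ← hpq, smul_add, add_sub_assoc, add_sub_cancel_left]
      exact add_mem hp (Submodule.smul_mem _ _ hqJ))
    rw [Submodule.sup_smul, ← sup_assoc, ← sub_add_cancel f (x • h)]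
    exact add_mem (Submodule.mem_sup_left key) (Submodule.mem_sup_right
      (Submodule.smul_mem_smul (Ideal.mem_span_singleton_self x) Submodule.mem_top))

/-- Since `𝔪 ^ 2 ⊆ (xs)`, minimality makes every element of `𝔪G` a cycle modulo `xs`. -/
lemma maximalIdeal_smul_top_le_range_sup (d : ∀ n, G (n + 1) →ₗ[R] G n)
    (hex : ∀ n, Function.Exact (d (n + 1)) (d n))
    (h0 : maximalIdeal R • ⊤ ≤ LinearMap.range (d 0))
    (hmin : ∀ n, LinearMap.range (d n) ≤ maximalIdeal R • ⊤)
    {xs : List R} (hm : ∀ r ∈ xs, r ∈ maximalIdeal R) (hreg : IsWeaklyRegular R xs)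
    (hind : IsIndependentModSq R xs) (hsq : maximalIdeal R ^ 2 ≤ Ideal.ofList xs) (n : ℕ) :
    maximalIdeal R • ⊤ ≤ LinearMap.range (d n) ⊔ Ideal.ofList xs • ⊤ := by
  rcases n with _ | n
  · exact h0.trans le_sup_left
  · intro f hf
    have := mem_range_sup_of_map_mem d hex h0 hmin hm hreg hind xs.length le_rfl n f hf (by
      rw [List.take_length]
      refine Submodule.smul_mono_left hsq ?_
      rw [pow_two]
      exact map_mem_ideal_mul_smul_top (hmin n) hf)
    rwa [List.take_length] at this

end Syzygies

/-! ### Base change, and images of syzygies -/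

section BaseChange

variable {R S : Type*} [CommRing R] [CommRing S] [Algebra R S] {M N : Type*} [AddCommGroup M]
  [Module R M] [AddCommGroup N] [Module R N]

lemma tmul_mem_map_smul_top {I : Ideal R} {v : M} (hv : v ∈ (I • ⊤ : Submodule R M)) (s : S) :
    s ⊗ₜ[R] v ∈ (I.map (algebraMap R S) • ⊤ : Submodule S (S ⊗[R] M)) := by
  induction hv using Submodule.smul_induction_on' with
  | smul r hr w _ =>
    rw [← smul_tmul, algebra_compatible_smul S r s, ← smul_tmul']
    exact Submodule.smul_mem_smul (Ideal.mem_map_of_mem _ hr) Submodule.mem_top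
  | add x _ y _ hx hy => rw [tmul_add]; exact add_mem hx hy

lemma range_baseChange_le {f : M →ₗ[R] N} {I : Ideal R} (h : LinearMap.range f ≤ I • ⊤) :
    LinearMap.range (f.baseChange S) ≤ I.map (algebraMap R S) • ⊤ := by
  rintro _ ⟨w, rfl⟩
  induction w with
  | zero => simp
  | tmul s v => exact tmul_mem_map_smul_top (h ⟨v, rfl⟩) s
  | add x y hx hy => rw [map_add]; exact add_mem hx hy

lemma map_smul_top_le_range_baseChange {f : M →ₗ[R] N} {I : Ideal R}
    (h : I • ⊤ ≤ LinearMap.range f) :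
    I.map (algebraMap R S) • ⊤ ≤ LinearMap.range (f.baseChange S) := by
  rw [Submodule.smul_le]
  intro r hr g _
  have hle : I.map (algebraMap R S) ≤ (LinearMap.range (f.baseChange S)).colon {g} := by
    refine Ideal.map_le_iff_le_comap.mpr fun a ha ↦ ?_
    rw [Ideal.mem_comap, Submodule.mem_colon_singleton]
    induction g with
    | zero => simp
    | tmul s v =>
      obtain ⟨w, hw⟩ := h (Submodule.smul_mem_smul ha (Submodule.mem_top (x := v)))
      refine ⟨s ⊗ₜ w, ?_⟩
      rw [LinearMap.baseChange_tmul, hw, ← smul_tmul, algebra_compatible_smul S a s, smul_tmul']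
    | add x y hx hy =>
      rw [smul_add]
      exact add_mem (hx Submodule.mem_top) (hy Submodule.mem_top)
  exact Submodule.mem_colon_singleton.mp (hle hr)

lemma smul_top_le_smul_top_of_surjective {f : M →ₗ[R] N} (hf : Function.Surjective f)
    {I J : Ideal R} (h : I • (⊤ : Submodule R M) ≤ LinearMap.ker f ⊔ J • ⊤) :
    I • (⊤ : Submodule R N) ≤ J • ⊤ := by
  have hk : (LinearMap.ker f).map f = ⊥ := le_bot_iff.mp (by rintro _ ⟨y, hy, rfl⟩; exact hy)
  have := Submodule.map_mono (f := f) h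
  rwa [Submodule.map_smul'', Submodule.map_sup, Submodule.map_smul'', Submodule.map_top,
    LinearMap.range_eq_top.mpr hf, hk, bot_sup_eq] at this

end BaseChange

section SyzygyModules

variable {R : Type u} [CommRing R] [IsLocalRing R] {S : Type u} [CommRing S] [IsLocalRing S]
  [Algebra R S] [Module.Flat R S]

/-- The `n`th syzygy is the cokernel of `d n`, so the inclusion `𝔪G ⊆ range (d n) + (xs)G` descends
to it. -/
lemma MinimalFreeResolution.maximalIdeal_smul_le
    (F : MinimalFreeResolution R (ResidueField R))
    (hmS : (maximalIdeal R).map (algebraMap R S) = maximalIdeal S)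
    {xs : List S} (hm : ∀ r ∈ xs, r ∈ maximalIdeal S) (hreg : IsWeaklyRegular S xs)
    (hind : IsIndependentModSq S xs) (hsq : maximalIdeal S ^ 2 ≤ Ideal.ofList xs) (n : ℕ) :
    maximalIdeal S • (⊤ : Submodule S (S ⊗[R] F.syzygy n)) ≤ Ideal.ofList xs • ⊤ := by
  have key := maximalIdeal_smul_top_le_range_sup
    (G := fun n ↦ S ⊗[R] (Fin (F.rank n) → R)) (fun n ↦ (F.d n).baseChange S)
    (fun n ↦ Module.Flat.lTensor_exact S (F.exact_d n))
    (by
      rw [← hmS]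
      refine map_smul_top_le_range_baseChange ?_
      rw [Submodule.smul_le]
      intro a ha v _
      refine (F.exact_ε _).mp ?_
      rw [map_smul, algebra_compatible_smul (ResidueField R), ResidueField.algebraMap_eq,
        (residue_eq_zero_iff a).mpr ha, zero_smul])
    (fun n ↦ by rw [← hmS]; exact range_baseChange_le (F.minimal n)) hm hreg hind hsq n
  obtain ⟨g, hg, hgex⟩ : ∃ g : (Fin (F.rank n) → R) →ₗ[R] F.syzygy n,
      Function.Surjective g ∧ Function.Exact (F.d n) g := by
    rcases n with _ | n
    · refine ⟨F.ε.rangeRestrict, F.ε.surjective_rangeRestrict, ?_⟩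
      exact fun y ↦ Subtype.ext_iff.trans (F.exact_ε y)
    · refine ⟨(F.d n).rangeRestrict, (F.d n).surjective_rangeRestrict, ?_⟩
      exact fun y ↦ Subtype.ext_iff.trans (F.exact_d n y)
  refine smul_top_le_smul_top_of_surjective (f := g.baseChange S)
    (LinearMap.lTensor_surjective S hg) (key.trans ?_)
  gcongr
  rintro _ ⟨w, rfl⟩
  exact (lTensor_exact S hgex hg).apply_apply_eq_zero w

lemma IsImageOfSyzygies.maximalIdeal_smul_le {M : Type u} [AddCommGroup M] [Module R M]
    (h : IsImageOfSyzygies R M)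
    (hmS : (maximalIdeal R).map (algebraMap R S) = maximalIdeal S)
    {xs : List S} (hm : ∀ r ∈ xs, r ∈ maximalIdeal S) (hreg : IsWeaklyRegular S xs)
    (hind : IsIndependentModSq S xs) (hsq : maximalIdeal S ^ 2 ≤ Ideal.ofList xs) :
    maximalIdeal S • (⊤ : Submodule S (S ⊗[R] M)) ≤ Ideal.ofList xs • ⊤ := by
  obtain ⟨F, r, n, f, hf⟩ := h
  rw [Submodule.smul_le]
  intro a ha w _
  induction w with
  | zero => simp
  | add x y hx hy =>
    rw [smul_add]; exact add_mem (hx Submodule.mem_top) (hy Submodule.mem_top)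
  | tmul s v =>
    obtain ⟨z, rfl⟩ := hf v
    induction z using DirectSum.induction_on with
    | zero => simp
    | add x y hx hy =>
      rw [map_add, tmul_add, smul_add]
      exact add_mem (hx Submodule.mem_top) (hy Submodule.mem_top)
    | of i z =>
      have h1 := F.maximalIdeal_smul_le hmS hm hreg hind hsq (n i)
        (Submodule.smul_mem_smul ha (Submodule.mem_top (x := s ⊗ₜ[R] z)))
      have h2 := map_mem_ideal_smul_top
        ((f ∘ₗ DirectSum.lof R (Fin r) (fun i ↦ F.syzygy (n i)) i).baseChange S) h1
      simpa [DirectSum.lof_eq_of] using h2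

end SyzygyModules

/-! ### Matrix complexes with coefficients in a module -/

section MatrixAction

variable {R : Type*} [CommRing R] {a b c e : ℕ}

/-- The action of a matrix on column vectors with entries in a module. -/
def matrixAction (A : Matrix (Fin a) (Fin b) R) (W : Type*) [AddCommGroup W] [Module R W] :
    (Fin b → W) →ₗ[R] (Fin a → W) :=
  LinearMap.pi fun i ↦ ∑ j, A i j • LinearMap.proj j

variable {W : Type*} [AddCommGroup W] [Module R W]

@[simp]
lemma matrixAction_apply (A : Matrix (Fin a) (Fin b) R) (v : Fin b → W) (i : Fin a) :
    matrixAction A W v i = ∑ j, A i j • v j := by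
  simp [matrixAction]

lemma matrixAction_comp_map {V : Type*} [AddCommGroup V] [Module R V] (f : W →ₗ[R] V)
    (A : Matrix (Fin a) (Fin b) R) (v : Fin b → W) :
    matrixAction A V (f ∘ v) = f ∘ matrixAction A W v := by
  ext i; simp

/-- Exactness of a matrix complex on `W` at two consecutive spots passes to exactness at the first
spot on the quotient by an injective endomorphism. -/
lemma exact_matrixAction_quotient {A : Matrix (Fin b) (Fin a) R} {B : Matrix (Fin c) (Fin b) R}
    {C : Matrix (Fin e) (Fin c) R} {V : Type*} [AddCommGroup V] [Module R V]
    {f : W →ₗ[R] W} {g : W →ₗ[R] V} (hf : Function.Injective f) (hg : Function.Surjective g)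
    (hfg : Function.Exact f g)
    (h₁ : Function.Exact (matrixAction A W) (matrixAction B W))
    (h₂ : Function.Exact (matrixAction B W) (matrixAction C W)) :
    Function.Exact (matrixAction A V) (matrixAction B V) := by
  have lift {n : ℕ} (v : Fin n → V) : ∃ w : Fin n → W, g ∘ w = v :=
    ⟨fun i ↦ (hg (v i)).choose, funext fun i ↦ (hg (v i)).choose_spec⟩
  have lift' {n : ℕ} (w : Fin n → W) (hw : g ∘ w = 0) : ∃ w' : Fin n → W, f ∘ w' = w := by
    choose w' hw' using fun i ↦ (hfg (w i)).mp (congrFun hw i)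
    exact ⟨w', funext hw'⟩
  have comp0 {n : ℕ} (w : Fin n → W) : g ∘ f ∘ w = 0 :=
    funext fun i ↦ hfg.apply_apply_eq_zero (w i)
  -- This is the long exact sequence of `0 → W → W → V → 0`: homology of `V` at a spot lies between
  -- that of `W` there and at the next spot.
  intro v
  constructor
  · intro hv
    obtain ⟨u, rfl⟩ := lift v
    rw [matrixAction_comp_map] at hv
    obtain ⟨w, hw⟩ := lift' _ hv
    have h3 : matrixAction C W w = 0 := by
      have h4 : f ∘ matrixAction C W w = 0 := by
        rw [← matrixAction_comp_map, hw, h₂.apply_apply_eq_zero]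
      exact funext fun i ↦ hf (by simpa using congrFun h4 i)
    obtain ⟨t, rfl⟩ := (h₂ w).mp h3
    have h5 : matrixAction B W (u - f ∘ t) = 0 := by
      rw [map_sub, matrixAction_comp_map, hw, sub_self]
    obtain ⟨s, hs⟩ := (h₁ _).mp h5
    refine ⟨g ∘ s, ?_⟩
    rw [matrixAction_comp_map, hs]
    have : g ∘ (u - f ∘ t) = g ∘ u - g ∘ f ∘ t := by ext i; simp
    rw [this, comp0, sub_zero]
  · rintro ⟨s, rfl⟩
    obtain ⟨s, rfl⟩ := lift s
    rw [matrixAction_comp_map, matrixAction_comp_map, h₁.apply_apply_eq_zero]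
    ext i; simp

lemma exact_matrixAction_congr {A : Matrix (Fin b) (Fin a) R} {B : Matrix (Fin c) (Fin b) R}
    {V : Type*} [AddCommGroup V] [Module R V] (f : W ≃ₗ[R] V)
    (h : Function.Exact (matrixAction A W) (matrixAction B W)) :
    Function.Exact (matrixAction A V) (matrixAction B V) := by
  refine (Function.Exact.iff_of_ladder_linearEquiv (e₁ := LinearEquiv.piCongrRight fun _ ↦ f)
    (e₂ := LinearEquiv.piCongrRight fun _ ↦ f) (e₃ := LinearEquiv.piCongrRight fun _ ↦ f)
    ?_ ?_).mpr h
  all_goals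
    ext v i
    simp

lemma exact_matrixAction_tensorProduct {S : Type*} [CommRing S] [Algebra R S] [Module.Flat R S]
    {A : Matrix (Fin b) (Fin a) R} {B : Matrix (Fin c) (Fin b) R}
    (h : Function.Exact (matrixAction A W) (matrixAction B W)) :
    Function.Exact (matrixAction A (S ⊗[R] W)) (matrixAction B (S ⊗[R] W)) := by
  have h1 := Module.Flat.lTensor_exact S h
  refine (Function.Exact.iff_of_ladder_linearEquiv
    (e₁ := TensorProduct.piRight R R S fun _ : Fin a ↦ W)
    (e₂ := TensorProduct.piRight R R S fun _ : Fin b ↦ W)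
    (e₃ := TensorProduct.piRight R R S fun _ : Fin c ↦ W) ?_ ?_).mpr h1
  all_goals
    refine TensorProduct.ext' fun s w ↦ funext fun i ↦ ?_
    simp [tmul_sum]

variable {S : Type*} [CommRing S] [Algebra R S] [Module S W] [IsScalarTower R S W]

lemma exact_matrixAction_of_isSMulRegular {A : Matrix (Fin b) (Fin a) R}
    {B : Matrix (Fin c) (Fin b) R} {C : Matrix (Fin e) (Fin c) R} {x : S}
    (hx : IsSMulRegular W x) {V : Type*} [AddCommGroup V] [Module R V] [Module S V]
    [IsScalarTower R S V] {g : W →ₗ[S] V} (hg : Function.Surjective g)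
    (hxg : Function.Exact (LinearMap.lsmul S W x) g)
    (h₁ : Function.Exact (matrixAction A W) (matrixAction B W))
    (h₂ : Function.Exact (matrixAction B W) (matrixAction C W)) :
    Function.Exact (matrixAction A V) (matrixAction B V) :=
  exact_matrixAction_quotient (f := (LinearMap.lsmul S W x).restrictScalars R)
    (g := g.restrictScalars R) hx hg hxg h₁ h₂

lemma exact_matrixAction_quotSMulTop {A : Matrix (Fin b) (Fin a) R} {B : Matrix (Fin c) (Fin b) R}
    {C : Matrix (Fin e) (Fin c) R} {x : S} (hx : IsSMulRegular W x)
    (h₁ : Function.Exact (matrixAction A W) (matrixAction B W))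
    (h₂ : Function.Exact (matrixAction B W) (matrixAction C W)) :
    Function.Exact (matrixAction A (QuotSMulTop x W)) (matrixAction B (QuotSMulTop x W)) := by
  have hex := LinearMap.exact_lsmul_mkQ_smul_top W x
  exact exact_matrixAction_of_isSMulRegular hx (Submodule.mkQ_surjective _) hex h₁ h₂

/-- The equivalence that divides out a sequence one element at a time. -/
def quotOfListConsEquiv (R : Type*) [CommRing R] {S : Type*} [CommRing S] [Algebra R S]
    (W : Type*) [AddCommGroup W] [Module R W] [Module S W] [IsScalarTower R S W]
    (x : S) (xs : List S) :
    (QuotSMulTop x W ⧸ (Ideal.ofList xs • ⊤ : Submodule S (QuotSMulTop x W))) ≃ₗ[R]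
      W ⧸ (Ideal.ofList (x :: xs) • ⊤ : Submodule S W) :=
  (Submodule.quotOfListConsSMulTopEquivQuotSMulTopInner W x xs).symm.restrictScalars R

/-- The quotient by the empty sequence. -/
def quotOfListNilEquiv (R : Type*) [CommRing R] (S : Type*) [CommRing S] [Algebra R S]
    (W : Type*) [AddCommGroup W] [Module R W] [Module S W] [IsScalarTower R S W] :
    W ≃ₗ[R] W ⧸ (Ideal.ofList ([] : List S) • ⊤ : Submodule S W) :=
  (Submodule.quotEquivOfEqBot (Ideal.ofList ([] : List S) • ⊤ : Submodule S W)
    (by rw [Ideal.ofList_nil, Submodule.bot_smul])).symm.restrictScalars R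

/-- Each member of `xs` uses up the last exact spot in the direction of the differential, so the
lowest index survives. -/
lemma exact_matrixAction_quotient_of_cochain {r : ℕ → ℕ}
    (B : ∀ j, Matrix (Fin (r (j + 1))) (Fin (r j)) R) {xs : List S} (hxs : IsWeaklyRegular W xs)
    (n : ℕ) (h : ∀ j, n ≤ j → j ≤ n + xs.length →
      Function.Exact (matrixAction (B j) W) (matrixAction (B (j + 1)) W)) :
    Function.Exact (matrixAction (B n) (W ⧸ (Ideal.ofList xs • ⊤ : Submodule S W)))
      (matrixAction (B (n + 1)) (W ⧸ (Ideal.ofList xs • ⊤ : Submodule S W))) := by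
  induction xs generalizing W with
  | nil => exact exact_matrixAction_congr (quotOfListNilEquiv R S W) (h n le_rfl (by simp))
  | cons x xs ih =>
    obtain ⟨hx, hxs⟩ := (isWeaklyRegular_cons_iff W x xs).mp hxs
    rw [List.length_cons] at h
    refine exact_matrixAction_congr (quotOfListConsEquiv R W x xs) (ih hxs fun j h1 h2 ↦ ?_)
    exact exact_matrixAction_quotSMulTop hx (h j h1 (by omega)) (h (j + 1) (by omega) (by omega))

/-- The differential now lowers the index, so it is the highest index `k` that survives. -/
lemma exact_matrixAction_quotient_of_chain {r : ℕ → ℕ}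
    (A : ∀ j, Matrix (Fin (r j)) (Fin (r (j + 1))) R) {xs : List S} (hxs : IsWeaklyRegular W xs)
    (n k : ℕ) (hk : n + xs.length = k) (h : ∀ j, n ≤ j → j ≤ k →
      Function.Exact (matrixAction (A (j + 1)) W) (matrixAction (A j) W)) :
    Function.Exact (matrixAction (A (k + 1)) (W ⧸ (Ideal.ofList xs • ⊤ : Submodule S W)))
      (matrixAction (A k) (W ⧸ (Ideal.ofList xs • ⊤ : Submodule S W))) := by
  induction xs generalizing W n with
  | nil =>
    rw [List.length_nil] at hk
    exact exact_matrixAction_congr (quotOfListNilEquiv R S W) (h k (by omega) le_rfl)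
  | cons x xs ih =>
    obtain ⟨hx, hxs⟩ := (isWeaklyRegular_cons_iff W x xs).mp hxs
    rw [List.length_cons] at hk
    refine exact_matrixAction_congr (quotOfListConsEquiv R W x xs)
      (ih hxs (n + 1) (by omega) fun j h1 h2 ↦ ?_)
    obtain ⟨j, rfl⟩ : ∃ i, j = i + 1 := ⟨j - 1, by omega⟩
    exact exact_matrixAction_quotSMulTop hx (h (j + 1) (by omega) (by omega))
      (h j (by omega) (by omega))

/-- Both maps are zero, so exactness forces the middle term `W ^ b` to vanish. -/
lemma eq_zero_of_exact_matrixAction [Nontrivial W] {A : Matrix (Fin b) (Fin a) R}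
    {B : Matrix (Fin c) (Fin b) R} (hA : ∀ i j (w : W), A i j • w = 0)
    (hB : ∀ i j (w : W), B i j • w = 0)
    (h : Function.Exact (matrixAction A W) (matrixAction B W)) : b = 0 := by
  by_contra hb
  obtain ⟨w, hw⟩ := exists_ne (0 : W)
  obtain ⟨v, hv⟩ := (h fun _ ↦ w).mp (by ext i; simp [hB])
  have := congrFun hv ⟨0, Nat.pos_of_ne_zero hb⟩
  simp only [matrixAction_apply, hA, Finset.sum_const_zero] at this
  exact hw this.symm

end MatrixAction

/-! ### Existence of minimal free resolutions -/

section Existence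

variable {R : Type u} [CommRing R] [IsLocalRing R]

/-- With the least possible number of generators, a relation with a unit coordinate would make one
generator redundant. -/
lemma exists_minimal_cover (M : Type*) [AddCommGroup M] [Module R M] [Module.Finite R M] :
    ∃ (n : ℕ) (p : (Fin n → R) →ₗ[R] M), Function.Surjective p ∧
      LinearMap.ker p ≤ maximalIdeal R • ⊤ := by
  classical
  have hex : ∃ (n : ℕ) (p : (Fin n → R) →ₗ[R] M), Function.Surjective p :=
    Module.Finite.exists_fin' R M
  refine ⟨Nat.find hex, (Nat.find_spec hex).choose, (Nat.find_spec hex).choose_spec, ?_⟩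
  have hmin := fun k ↦ Nat.find_min (m := k) hex
  have hp := (Nat.find_spec hex).choose_spec
  generalize (Nat.find_spec hex).choose = p at *
  generalize Nat.find hex = n at *
  intro v hv
  rw [mem_ideal_smul_top_iff_repr (Pi.basisFun R (Fin n))]
  intro i
  by_contra hi
  rw [mem_maximalIdeal, mem_nonunits_iff, not_not, Pi.basisFun_repr] at hi
  obtain ⟨t, ht⟩ := hi
  rcases n with _ | n
  · exact i.elim0
  refine hmin n (Nat.lt_succ_self n)
    ⟨p ∘ₗ LinearMap.pi fun j ↦ ?_, fun y ↦ ?_⟩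
  · exact if h : j = i then 0 else LinearMap.proj ((finSuccAboveEquiv i).symm ⟨j, h⟩)
  · obtain ⟨w, rfl⟩ := hp y
    refine ⟨fun j ↦ (w - (w i * ↑t⁻¹) • v) (i.succAbove j), ?_⟩
    have hv0 : p v = 0 := hv
    have : p w = p (w - (w i * ↑t⁻¹) • v) := by simp [hv0]
    rw [this, LinearMap.comp_apply]
    congr 1
    ext j
    by_cases h : j = i
    · subst h
      simp [← ht]
    · have h2 : i.succAbove ((finSuccAboveEquiv i).symm ⟨j, h⟩) = j := by
        have := (finSuccAboveEquiv i).apply_symm_apply ⟨j, h⟩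
        exact congrArg Subtype.val this
      simp [h, h2]

/-- The number of generators in a minimal cover. -/
def coverRank (M : Type*) [AddCommGroup M] [Module R M] [Module.Finite R M] : ℕ :=
  (exists_minimal_cover (R := R) M).choose

/-- A minimal free cover. -/
def cover (M : Type*) [AddCommGroup M] [Module R M] [Module.Finite R M] :
    (Fin (coverRank (R := R) M) → R) →ₗ[R] M :=
  (exists_minimal_cover (R := R) M).choose_spec.choose

lemma cover_surjective (M : Type*) [AddCommGroup M] [Module R M] [Module.Finite R M] :
    Function.Surjective (cover (R := R) M) :=
  (exists_minimal_cover (R := R) M).choose_spec.choose_spec.1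

lemma ker_cover_le (M : Type*) [AddCommGroup M] [Module R M] [Module.Finite R M] :
    LinearMap.ker (cover (R := R) M) ≤ maximalIdeal R • ⊤ :=
  (exists_minimal_cover (R := R) M).choose_spec.choose_spec.2

variable [IsNoetherianRing R]

/-- The kernel of the minimal cover of a submodule of a free module. -/
def nextSyzygy (K : Σ a : ℕ, Submodule R (Fin a → R)) : Σ a : ℕ, Submodule R (Fin a → R) :=
  ⟨coverRank (R := R) K.2, LinearMap.ker (cover K.2)⟩

/-- The minimal cover of a submodule of a free module, as a map between free modules. -/
def coverMap (K : Σ a : ℕ, Submodule R (Fin a → R)) :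
    (Fin (nextSyzygy K).1 → R) →ₗ[R] (Fin K.1 → R) :=
  K.2.subtype ∘ₗ cover K.2

lemma mem_range_coverMap (K : Σ a : ℕ, Submodule R (Fin a → R)) (y : Fin K.1 → R) :
    y ∈ K.2 ↔ y ∈ Set.range (coverMap K) := by
  refine ⟨fun hy ↦ ?_, ?_⟩
  · obtain ⟨x, hx⟩ := cover_surjective (R := R) K.2 ⟨y, hy⟩
    exact ⟨x, congrArg Subtype.val hx⟩
  · rintro ⟨x, rfl⟩
    exact (cover (R := R) K.2 x).2

lemma coverMap_eq_zero_iff (K : Σ a : ℕ, Submodule R (Fin a → R)) (x : Fin (nextSyzygy K).1 → R) :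
    coverMap K x = 0 ↔ x ∈ (nextSyzygy K).2 := by
  change (cover (R := R) K.2 x : Fin K.1 → R) = 0 ↔ cover (R := R) K.2 x = 0
  exact Submodule.coe_eq_zero

lemma nextSyzygy_le (K : Σ a : ℕ, Submodule R (Fin a → R)) :
    (nextSyzygy K).2 ≤ maximalIdeal R • ⊤ :=
  ker_cover_le _

/-- The iterated kernels of minimal covers. -/
def iteratedSyzygy (M : Type*) [AddCommGroup M] [Module R M] [Module.Finite R M] (n : ℕ) :
    Σ a : ℕ, Submodule R (Fin a → R) :=
  Nat.rec ⟨coverRank (R := R) M, LinearMap.ker (cover M)⟩ (fun _ ↦ nextSyzygy) n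

lemma iteratedSyzygy_le (M : Type*) [AddCommGroup M] [Module R M] [Module.Finite R M] (n : ℕ) :
    (iteratedSyzygy (R := R) M n).2 ≤ maximalIdeal R • ⊤ := by
  cases n with
  | zero => exact ker_cover_le M
  | succ n => exact nextSyzygy_le (iteratedSyzygy M n)

/-- A finitely generated module over a Noetherian local ring has a minimal free resolution. -/
def minimalFreeResolution (M : Type u) [AddCommGroup M] [Module R M] [Module.Finite R M] :
    MinimalFreeResolution R M where
  rank n := (iteratedSyzygy (R := R) M n).1
  d n := coverMap (iteratedSyzygy M n)
  ε := cover M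
  surjective_ε := cover_surjective M
  exact_ε := mem_range_coverMap (iteratedSyzygy M 0)
  exact_d n x := (coverMap_eq_zero_iff (iteratedSyzygy M n) x).trans
    (mem_range_coverMap (iteratedSyzygy M (n + 1)) x)
  minimal n := by
    rintro _ ⟨x, rfl⟩
    exact iteratedSyzygy_le M n ((mem_range_coverMap (iteratedSyzygy M n) _).mpr ⟨x, rfl⟩)

end Existence

/-! ### Computing `Ext` and `Tor` from a minimal resolution -/

section ProjectiveResolution

lemma quasiIsoAt_zero_toSingle {C : Type*} [Category C] [Abelian C] (K : ChainComplex C ℕ) {Z : C}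
    (π : K ⟶ (ChainComplex.single₀ C).obj Z) (φ : K.X 0 ⟶ Z) (hφ : K.d 1 0 ≫ φ = 0)
    (hπ : π.f 0 = φ)
    (h : (ShortComplex.mk _ _ hφ).Exact) (hepi : Epi φ) : QuasiIsoAt π 0 := by
  subst hπ
  rw [ChainComplex.quasiIsoAt₀_iff,
    ShortComplex.quasiIso_iff_of_zeros' _ (K.shape _ _ (by simp)) rfl rfl]
  exact ⟨h, hepi⟩

variable {R : Type u} [CommRing R] [IsLocalRing R] {M : Type u} [AddCommGroup M] [Module R M]
  (F : MinimalFreeResolution R M)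

/-- The chain complex of a free resolution. -/
def MinimalFreeResolution.complex : ChainComplex (ModuleCat.{u} R) ℕ :=
  ChainComplex.of (fun n ↦ ModuleCat.of R (Fin (F.rank n) → R)) (fun n ↦ ModuleCat.ofHom (F.d n))
    fun n ↦ by
      rw [← ModuleCat.ofHom_comp, (F.exact_d n).linearMap_comp_eq_zero]
      rfl

lemma MinimalFreeResolution.complex_d (n : ℕ) :
    F.complex.d (n + 1) n = ModuleCat.ofHom (F.d n) :=
  ChainComplex.of_d (fun n ↦ ModuleCat.of R (Fin (F.rank n) → R))
    (fun n ↦ ModuleCat.ofHom (F.d n)) n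

lemma MinimalFreeResolution.exactAt_complex (n : ℕ) : F.complex.ExactAt (n + 1) := by
  rw [HomologicalComplex.exactAt_iff' _ (n + 1 + 1) (n + 1) n (by simp) (by simp)]
  refine ModuleCat.shortComplex_exact _ ?_
  change Function.Exact (F.complex.d (n + 1 + 1) (n + 1)).hom (F.complex.d (n + 1) n).hom
  rw [F.complex_d, F.complex_d]
  exact F.exact_d n

/-- A free resolution as a projective resolution. -/
def MinimalFreeResolution.projectiveResolution : ProjectiveResolution (ModuleCat.of R M) where
  complex := F.complex
  projective n := ModuleCat.projective_of_free (Pi.basisFun R (Fin (F.rank n)))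
  π := (ChainComplex.toSingle₀Equiv _ _).symm ⟨ModuleCat.ofHom F.ε, by
    rw [F.complex_d]
    exact (ModuleCat.ofHom_comp _ _).symm.trans (by
      rw [F.exact_ε.linearMap_comp_eq_zero]; rfl)⟩
  quasiIso := ⟨fun n ↦ by
    cases n with
    | zero =>
      have hε : Epi (ModuleCat.ofHom F.ε) := (ModuleCat.epi_iff_surjective _).mpr F.surjective_ε
      refine quasiIsoAt_zero_toSingle _ _ (ModuleCat.ofHom F.ε) ?_
        (ChainComplex.toSingle₀Equiv_symm_apply_f_zero _ _) ?_ hε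
      · rw [F.complex_d]
        exact (ModuleCat.ofHom_comp _ _).symm.trans (by
          rw [F.exact_ε.linearMap_comp_eq_zero]; rfl)
      · refine ModuleCat.shortComplex_exact _ ?_
        have h : (F.complex.d 1 0).hom = F.d 0 := congrArg ModuleCat.Hom.hom (F.complex_d 0)
        change Function.Exact (F.complex.d 1 0).hom F.ε
        rw [h]
        exact F.exact_ε
    | succ n =>
      rw [quasiIsoAt_iff_exactAt']
      · exact F.exactAt_complex n
      · exact ChainComplex.exactAt_succ_single_obj _ _⟩

variable {N : Type u} [AddCommGroup N] [Module R N]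

lemma MinimalFreeResolution.exists_comp_d_eq_of_extVanishes (i : ℕ)
    (h : ExtVanishes R M N (i + 1)) (φ : (Fin (F.rank (i + 1)) → R) →ₗ[R] N)
    (hφ : φ ∘ₗ F.d (i + 1) = 0) : ∃ ψ : (Fin (F.rank i) → R) →ₗ[R] N, ψ ∘ₗ F.d i = φ := by
  have h0 : F.projectiveResolution.complex.d (i + 2) (i + 1) ≫ ModuleCat.ofHom φ = 0 := by
    change F.complex.d (i + 1 + 1) (i + 1) ≫ _ = 0
    rw [F.complex_d]
    exact (ModuleCat.ofHom_comp _ _).symm.trans (by rw [hφ]; rfl)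
  obtain ⟨g, hg⟩ := (F.projectiveResolution.extMk_eq_zero_iff (Y := ModuleCat.of R N)
    (ModuleCat.ofHom φ) (i + 2) rfl h0 i rfl).mp (h.elim _ _)
  refine ⟨g.hom, ?_⟩
  change F.complex.d (i + 1) i ≫ _ = _ at hg
  rw [F.complex_d] at hg
  exact congrArg ModuleCat.Hom.hom hg

open MonoidalCategory in
-- `Tor` is derived in its second argument, so here the resolved module `M` comes second.
lemma MinimalFreeResolution.exact_lTensor_of_torVanishes (i : ℕ)
    (h : TorVanishes R N M (i + 1)) :
    Function.Exact ((F.d (i + 1)).lTensor N) ((F.d i).lTensor N) := by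
  let T : ModuleCat.{u} R ⥤ ModuleCat.{u} R := (tensoringLeft _).obj (ModuleCat.of R N)
  have h1 := h.of_iso (F.projectiveResolution.isoLeftDerivedObj T (i + 1)).symm
  have h2 : ((T.mapHomologicalComplex _).obj F.complex).ExactAt (i + 1) :=
    (HomologicalComplex.exactAt_iff_isZero_homology _ _).mpr h1
  rw [HomologicalComplex.exactAt_iff' _ (i + 1 + 1) (i + 1) i (by simp) (by simp)] at h2
  replace h2 := (ShortComplex.ShortExact.moduleCat_exact_iff_function_exact _).mp h2
  change Function.Exact (T.map (F.complex.d (i + 1 + 1) (i + 1))).hom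
    (T.map (F.complex.d (i + 1) i)).hom at h2
  rw [F.complex_d, F.complex_d] at h2
  exact h2

end ProjectiveResolution

section MatrixOfDifferential

variable {R : Type*} [CommRing R] {a b c : ℕ} {N : Type*} [AddCommGroup N] [Module R N]

/-- Under `Hom(R ^ a, N) ≅ N ^ a`, precomposition with `f` becomes the action of the transposed
matrix. -/
lemma linearCombination_comp (f : (Fin a → R) →ₗ[R] (Fin b → R)) (v : Fin b → N) :
    Fintype.linearCombination R v ∘ₗ f =
      Fintype.linearCombination R (matrixAction f.toMatrix'.transpose N v) := by
  refine (Pi.basisFun R (Fin a)).ext fun i ↦ ?_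
  simp [Fintype.linearCombination_apply, LinearMap.toMatrix'_apply, Pi.single_apply]

lemma linearCombination_injective :
    Function.Injective fun v : Fin a → N ↦ Fintype.linearCombination R v := by
  intro v w h
  ext i
  simpa using LinearMap.congr_fun h (Pi.single i 1)

lemma exists_linearCombination_eq (f : (Fin a → R) →ₗ[R] N) :
    ∃ v : Fin a → N, Fintype.linearCombination R v = f :=
  ⟨fun i ↦ f (Pi.single i 1), (Pi.basisFun R (Fin a)).ext fun i ↦ by simp⟩

lemma exact_matrixAction_transpose {f : (Fin a → R) →ₗ[R] (Fin b → R)}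
    {g : (Fin b → R) →ₗ[R] (Fin c → R)} (hgf : g ∘ₗ f = 0)
    (h : ∀ φ : (Fin b → R) →ₗ[R] N, φ ∘ₗ f = 0 → ∃ ψ : (Fin c → R) →ₗ[R] N, ψ ∘ₗ g = φ) :
    Function.Exact (matrixAction g.toMatrix'.transpose N)
      (matrixAction f.toMatrix'.transpose N) := by
  intro v
  constructor
  · intro hv
    obtain ⟨ψ, hψ⟩ := h (Fintype.linearCombination R v) (by
      rw [linearCombination_comp, hv]
      ext; simp)
    obtain ⟨w, rfl⟩ := exists_linearCombination_eq ψ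
    rw [linearCombination_comp] at hψ
    exact ⟨w, linearCombination_injective hψ⟩
  · rintro ⟨w, rfl⟩
    refine linearCombination_injective (R := R) ?_
    change Fintype.linearCombination R _ = Fintype.linearCombination R _
    rw [← linearCombination_comp, ← linearCombination_comp, LinearMap.comp_assoc, hgf]
    ext; simp

lemma exact_matrixAction_of_lTensor {f : (Fin a → R) →ₗ[R] (Fin b → R)}
    {g : (Fin b → R) →ₗ[R] (Fin c → R)} (h : Function.Exact (f.lTensor N) (g.lTensor N)) :
    Function.Exact (matrixAction f.toMatrix' N) (matrixAction g.toMatrix' N) := by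
  have key {a b : ℕ} (f : (Fin a → R) →ₗ[R] (Fin b → R)) :
      matrixAction f.toMatrix' N ∘ₗ (TensorProduct.piScalarRight R R N (Fin a)).toLinearMap =
        (TensorProduct.piScalarRight R R N (Fin b)).toLinearMap ∘ₗ f.lTensor N := by
    refine TensorProduct.ext' fun n v ↦ funext fun i ↦ ?_
    have h1 : f v i = ∑ j, f.toMatrix' i j * v j := by
      conv_lhs => rw [← Matrix.toLin'_toMatrix' f]
      rfl
    simp [h1, Finset.sum_smul, mul_smul]
  exact (Function.Exact.iff_of_ladder_linearEquiv (key f) (key g)).mpr h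

end MatrixOfDifferential

/-! ### Regular sequences in short exact sequences -/

section WeaklyRegular

variable {S : Type*} [CommRing S] {A B C : Type*} [AddCommGroup A] [Module S A]
  [AddCommGroup B] [Module S B] [AddCommGroup C] [Module S C]

/-- Regularity of `xs` on the cokernel `C` keeps `A → B` injective modulo `xs`. -/
lemma mem_smul_top_of_map_mem {f : A →ₗ[S] B} {g : B →ₗ[S] C} (hf : Function.Injective f)
    (hg : Function.Surjective g) (hfg : Function.Exact f g) {xs : List S}
    (hC : IsWeaklyRegular C xs) {a : A} (ha : f a ∈ (Ideal.ofList xs • ⊤ : Submodule S B)) :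
    a ∈ (Ideal.ofList xs • ⊤ : Submodule S A) := by
  have h0 : Function.Exact (0 : A →ₗ[S] A) f := by
    intro x
    simp [map_eq_zero_iff f hf, eq_comm]
  have h1 := map_first_exact_on_four_term_right_exact_of_isSMulRegular_last h0 hfg hg hC
    (Submodule.Quotient.mk a)
  obtain ⟨y, hy⟩ := h1.mp (by
    rw [Submodule.mapQ_apply]
    exact (Submodule.Quotient.mk_eq_zero _).mpr ha)
  obtain ⟨y, rfl⟩ := Submodule.Quotient.mk_surjective _ y
  rw [Submodule.mapQ_apply, LinearMap.zero_apply, Submodule.Quotient.mk_zero] at hy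
  exact (Submodule.Quotient.mk_eq_zero _).mp hy.symm

lemma isWeaklyRegular_of_exact {f : A →ₗ[S] B} {g : B →ₗ[S] C} (hf : Function.Injective f)
    (hg : Function.Surjective g) (hfg : Function.Exact f g) {xs : List S}
    (hB : IsWeaklyRegular B xs) (hC : IsWeaklyRegular C xs) : IsWeaklyRegular A xs := by
  induction xs generalizing A B C with
  | nil => exact .nil _ _
  | cons x xs ih =>
    obtain ⟨hxB, hB⟩ := (isWeaklyRegular_cons_iff B x xs).mp hB
    obtain ⟨hxC, hC⟩ := (isWeaklyRegular_cons_iff C x xs).mp hC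
    refine (isWeaklyRegular_cons_iff A x xs).mpr ⟨hxB.of_injective f hf, ?_⟩
    refine ih (f := QuotSMulTop.map x f) (g := QuotSMulTop.map x g) ?_
      (QuotSMulTop.map_surjective x hg) (QuotSMulTop.map_exact x hfg hg) hB hC
    have h0 : Function.Exact (0 : A →ₗ[S] A) f := by
      intro y
      simp [map_eq_zero_iff f hf, eq_comm]
    have h1 := QuotSMulTop.map_first_exact_on_four_term_exact_of_isSMulRegular_last h0 hfg hxC
    rw [map_zero] at h1
    rw [injective_iff_map_eq_zero]
    intro y hy
    obtain ⟨z, hz⟩ := (h1 y).mp hy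
    exact hz.symm

lemma isWeaklyRegular_of_flat [Module.Flat S A] {xs : List S} (h : IsWeaklyRegular S xs) :
    IsWeaklyRegular A xs :=
  ((TensorProduct.rid S A).isWeaklyRegular_congr xs).mp h.isWeaklyRegular_lTensor

lemma isWeaklyRegular_range {G : ℕ → Type*} [∀ n, AddCommGroup (G n)] [∀ n, Module S (G n)]
    {d : ∀ n, G (n + 1) →ₗ[S] G n} {e : G 0 →ₗ[S] C} (he : Function.Surjective e)
    (hde : Function.Exact (d 0) e) (hd : ∀ n, Function.Exact (d (n + 1)) (d n)) {xs : List S}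
    (hG : ∀ n, IsWeaklyRegular (G n) xs) (hC : IsWeaklyRegular C xs) (n : ℕ) :
    IsWeaklyRegular (LinearMap.range (d n)) xs := by
  induction n with
  | zero =>
    refine isWeaklyRegular_of_exact (Submodule.subtype_injective _) he ?_ (hG 0) hC
    rw [LinearMap.exact_iff, Submodule.range_subtype, hde.linearMap_ker_eq]
  | succ n ih =>
    refine isWeaklyRegular_of_exact (Submodule.subtype_injective _)
      (d n).surjective_rangeRestrict ?_ (hG (n + 1)) ih
    rw [LinearMap.exact_iff, Submodule.range_subtype, LinearMap.ker_rangeRestrict,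
      (hd n).linearMap_ker_eq]

lemma le_of_smul_mem [Module.Free S A] [Nontrivial A] [Nontrivial S] {I J : Ideal S}
    (h : I • (⊤ : Submodule S A) ≤ J • ⊤) : I ≤ J := by
  let b := Module.Free.chooseBasis S A
  obtain ⟨i⟩ := b.index_nonempty
  intro r hr
  have := (mem_ideal_smul_top_iff_repr b J _).mp
    (h (Submodule.smul_mem_smul hr (Submodule.mem_top (x := b i)))) i
  simpa using this

/-- `f` sends `𝔪A` into `𝔪 ^ 2 B ⊆ (xs)B`, hence `𝔪A ⊆ (xs)A`, and a basis vector of `A` yields the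
inclusion of ideals. -/
lemma maximalIdeal_le_of_injective [IsLocalRing S] [Module.Free S A] [Nontrivial A]
    {f : A →ₗ[S] B} {g : B →ₗ[S] C} (hf : Function.Injective f) (hg : Function.Surjective g)
    (hfg : Function.Exact f g) {xs : List S} (hC : IsWeaklyRegular C xs)
    (hmin : LinearMap.range f ≤ maximalIdeal S • ⊤)
    (hsq : maximalIdeal S ^ 2 ≤ Ideal.ofList xs) : maximalIdeal S ≤ Ideal.ofList xs := by
  refine le_of_smul_mem (A := A) fun a ha ↦ mem_smul_top_of_map_mem hf hg hfg hC ?_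
  refine Submodule.smul_mono_left hsq ?_
  rw [pow_two]
  exact map_mem_ideal_mul_smul_top hmin ha

end WeaklyRegular

/-! ### From vanishing to regularity, and from regularity to freeness -/

section Resolution

variable {R : Type u} [CommRing R] [IsLocalRing R] {M : Type u} [AddCommGroup M] [Module R M]

lemma MinimalFreeResolution.toMatrix_mem (F : MinimalFreeResolution R M) (n : ℕ)
    (i : Fin (F.rank n)) (j : Fin (F.rank (n + 1))) :
    (F.d n).toMatrix' i j ∈ maximalIdeal R := by
  have h := (mem_ideal_smul_top_iff_repr (Pi.basisFun R _) _ _).mp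
    (F.minimal n ⟨Pi.single j 1, rfl⟩) i
  simpa [LinearMap.toMatrix'_apply, Pi.single_apply] using h

variable {S : Type u} [CommRing S] [IsLocalRing S] [Algebra R S] {N : Type u} [AddCommGroup N]
  [Module R N] {xs : List S}

lemma smul_quotient_eq_zero (hmS : (maximalIdeal R).map (algebraMap R S) = maximalIdeal S)
    (hN : maximalIdeal S • (⊤ : Submodule S (S ⊗[R] N)) ≤ Ideal.ofList xs • ⊤)
    {r : R} (hr : r ∈ maximalIdeal R)
    (w : (S ⊗[R] N) ⧸ (Ideal.ofList xs • ⊤ : Submodule S (S ⊗[R] N))) : r • w = 0 := by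
  obtain ⟨w, rfl⟩ := Submodule.Quotient.mk_surjective _ w
  rw [algebra_compatible_smul S r, ← Submodule.Quotient.mk_smul, Submodule.Quotient.mk_eq_zero]
  exact hN (Submodule.smul_mem_smul (hmS ▸ Ideal.mem_map_of_mem _ hr) Submodule.mem_top)

lemma nontrivial_quotient {W : Type*} [AddCommGroup W] [Module S W] [Module.Finite S W]
    [Nontrivial W] (hm : ∀ r ∈ xs, r ∈ maximalIdeal S) :
    Nontrivial (W ⧸ (Ideal.ofList xs • ⊤ : Submodule S W)) := by
  rw [Submodule.Quotient.nontrivial_iff]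
  intro h
  refine top_ne_bot (α := Submodule S W)
    (Submodule.eq_bot_of_le_smul_of_le_jacobson_bot _ _ Module.Finite.fg_top h.ge ?_)
  rw [jacobson_eq_maximalIdeal ⊥ bot_ne_top]
  exact Ideal.span_le.mpr hm

/-- As `xs` is regular on the cokernel, the image of `f` equals `(xs)` times itself, and Nakayama
applies. -/
lemma eq_zero_of_range_le {A B C : Type*} [AddCommGroup A] [Module S A] [AddCommGroup B]
    [Module S B] [AddCommGroup C] [Module S C] [Module.Finite S A] {f : A →ₗ[S] B} {g : B →ₗ[S] C}
    (hg : Function.Surjective g) (hfg : Function.Exact f g) (hm : ∀ r ∈ xs, r ∈ maximalIdeal S)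
    (hC : IsWeaklyRegular C xs) (hle : LinearMap.range f ≤ Ideal.ofList xs • ⊤) : f = 0 := by
  have hex : Function.Exact (LinearMap.range f).subtype g := by
    rw [LinearMap.exact_iff, Submodule.range_subtype, hfg.linearMap_ker_eq]
  have htop : (Ideal.ofList xs • ⊤ : Submodule S (LinearMap.range f)) = ⊤ :=
    top_le_iff.mp fun y _ ↦
      mem_smul_top_of_map_mem (Submodule.subtype_injective _) hg hex hC (hle y.2)
  have : Subsingleton (LinearMap.range f) := by
    by_contra hns
    rw [not_subsingleton_iff_nontrivial] at hns
    exact Submodule.Quotient.nontrivial_iff.mp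
      (nontrivial_quotient (W := LinearMap.range f) hm) htop
  rwa [Submodule.subsingleton_iff_eq_bot, LinearMap.range_eq_bot] at this

variable [Module.FaithfullyFlat R S] [Module.Finite R N] [Nontrivial N]

lemma MinimalFreeResolution.rank_eq_zero_of_extVanishes (F : MinimalFreeResolution R M)
    (hmS : (maximalIdeal R).map (algebraMap R S) = maximalIdeal S)
    (hm : ∀ r ∈ xs, r ∈ maximalIdeal S) (hreg : IsWeaklyRegular (S ⊗[R] N) xs)
    (hN : maximalIdeal S • (⊤ : Submodule S (S ⊗[R] N)) ≤ Ideal.ofList xs • ⊤) (n : ℕ)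
    (h : ∀ i, n + 1 ≤ i → i ≤ n + 1 + xs.length → ExtVanishes R M N i) :
    F.rank (n + 1) = 0 := by
  have := nontrivial_quotient (W := S ⊗[R] N) hm
  have key := exact_matrixAction_quotient_of_cochain
    (fun j ↦ (F.d j).toMatrix'.transpose) hreg n fun j h1 h2 ↦
      exact_matrixAction_tensorProduct (exact_matrixAction_transpose
        (F.exact_d j).linearMap_comp_eq_zero
        (F.exists_comp_d_eq_of_extVanishes j (h _ (by omega) (by omega))))
  exact eq_zero_of_exact_matrixAction
    (fun i j w ↦ smul_quotient_eq_zero hmS hN (F.toMatrix_mem _ _ _) w)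
    (fun i j w ↦ smul_quotient_eq_zero hmS hN (F.toMatrix_mem _ _ _) w) key

lemma MinimalFreeResolution.rank_eq_zero_of_torVanishes (F : MinimalFreeResolution R M)
    (hmS : (maximalIdeal R).map (algebraMap R S) = maximalIdeal S)
    (hm : ∀ r ∈ xs, r ∈ maximalIdeal S) (hreg : IsWeaklyRegular (S ⊗[R] N) xs)
    (hN : maximalIdeal S • (⊤ : Submodule S (S ⊗[R] N)) ≤ Ideal.ofList xs • ⊤) (n : ℕ)
    (h : ∀ i, n + 1 ≤ i → i ≤ n + 1 + xs.length → TorVanishes R N M i) :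
    F.rank (n + xs.length + 1) = 0 := by
  have := nontrivial_quotient (W := S ⊗[R] N) hm
  have key := exact_matrixAction_quotient_of_chain
    (fun j ↦ (F.d j).toMatrix') hreg n (n + xs.length) rfl fun j h1 h2 ↦
      exact_matrixAction_tensorProduct (exact_matrixAction_of_lTensor
        (F.exact_lTensor_of_torVanishes j (h _ (by omega) (by omega))))
  exact eq_zero_of_exact_matrixAction
    (fun i j w ↦ smul_quotient_eq_zero hmS hN (F.toMatrix_mem _ _ _) w)
    (fun i j w ↦ smul_quotient_eq_zero hmS hN (F.toMatrix_mem _ _ _) w) key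

lemma MinimalFreeResolution.maximalIdeal_le_of_rank_eq_zero [Nontrivial M]
    (F : MinimalFreeResolution R M)
    (hmS : (maximalIdeal R).map (algebraMap R S) = maximalIdeal S)
    (hreg : IsWeaklyRegular S xs) (hregM : IsWeaklyRegular (S ⊗[R] M) xs)
    (hM : maximalIdeal S • (⊤ : Submodule S (S ⊗[R] M)) ≤ Ideal.ofList xs • ⊤)
    (hsq : maximalIdeal S ^ 2 ≤ Ideal.ofList xs) {j : ℕ} (hj : F.rank j = 0) :
    maximalIdeal S ≤ Ideal.ofList xs := by
  classical
  have hex : ∃ j, F.rank j = 0 := ⟨j, hj⟩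
  have hspec := Nat.find_spec hex
  have hlt (k : ℕ) (hk : k < Nat.find hex) : F.rank k ≠ 0 := Nat.find_min hex hk
  -- `p` is the first index with `F_p = 0`, so `F_{p-1}` is nonzero and the differential out of it
  -- is injective.
  generalize Nat.find hex = p at *
  have nontriv (k : ℕ) (hk : F.rank k ≠ 0) : Nontrivial (Fin (F.rank k) → R) :=
    have : Nonempty (Fin (F.rank k)) := ⟨⟨0, Nat.pos_of_ne_zero hk⟩⟩
    inferInstance
  have subsing (k : ℕ) (hk : F.rank k = 0) : Subsingleton (Fin (F.rank k) → R) := by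
    rw [hk]; infer_instance
  have hbc (n : ℕ) : Function.Exact ((F.d (n + 1)).baseChange S) ((F.d n).baseChange S) :=
    Module.Flat.lTensor_exact S (F.exact_d n)
  have hbε : Function.Exact ((F.d 0).baseChange S) (F.ε.baseChange S) :=
    Module.Flat.lTensor_exact S F.exact_ε
  have hsε : Function.Surjective (F.ε.baseChange S) := LinearMap.lTensor_surjective S F.surjective_ε
  have hinj (n : ℕ) (h : F.rank (n + 2) = 0) : Function.Injective ((F.d n).baseChange S) := by
    have := subsing _ h
    refine Module.Flat.lTensor_preserves_injective_linearMap _ ?_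
    rw [injective_iff_map_eq_zero]
    intro y hy
    obtain ⟨z, rfl⟩ := (F.exact_d n y).mp hy
    rw [Subsingleton.elim z 0, map_zero]
  have hmin (n : ℕ) : LinearMap.range ((F.d n).baseChange S) ≤ maximalIdeal S • ⊤ := by
    rw [← hmS]; exact range_baseChange_le (F.minimal n)
  match p with
  | 0 =>
    have := subsing 0 hspec
    obtain ⟨y, hy⟩ := exists_ne (0 : M)
    obtain ⟨z, rfl⟩ := F.surjective_ε y
    exact absurd (by rw [Subsingleton.elim z 0, map_zero]) hy
  | 1 =>
    have := nontriv 0 (hlt 0 one_pos)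
    have h1 := subsing 1 hspec
    have hε : Function.Injective F.ε := by
      rw [injective_iff_map_eq_zero]
      intro y hy
      obtain ⟨z, rfl⟩ := (F.exact_ε y).mp hy
      rw [Subsingleton.elim z 0, map_zero]
    let e : (Fin (F.rank 0) → R) ≃ₗ[R] M := .ofBijective F.ε ⟨hε, F.surjective_ε⟩
    have : Module.Free R M := .of_equiv e
    -- Here `M` is free and nonzero, and the hypothesis that `𝔪` kills `M/(xs)M` is needed.
    exact le_of_smul_mem hM
  | 2 =>
    have := nontriv 1 (hlt 1 one_lt_two)
    exact maximalIdeal_le_of_injective (hinj 0 hspec) hsε hbε hregM (hmin 0) hsq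
  | n + 3 =>
    have := nontriv (n + 2) (hlt _ (by omega))
    -- The cokernel of the last differential is the image of `d n`, on which `xs` is regular because
    -- it is an iterated syzygy of `M`.
    refine maximalIdeal_le_of_injective (hinj (n + 1) hspec)
      ((F.d n).baseChange S).surjective_rangeRestrict ?_
      (isWeaklyRegular_range (G := fun n ↦ S ⊗[R] (Fin (F.rank n) → R))
        (d := fun n ↦ (F.d n).baseChange S) hsε hbε hbc (fun n ↦ isWeaklyRegular_of_flat hreg) hregM n)
      (hmin (n + 1)) hsq
    rw [LinearMap.exact_iff, LinearMap.ker_rangeRestrict, (hbc n).linearMap_ker_eq]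

/-- By minimality the first differential has image in `𝔪F_0 ⊆ (xs)F_0`, hence is zero over `S`;
faithful flatness brings this back to `R`, so the augmentation is an isomorphism. -/
lemma MinimalFreeResolution.free_of_maximalIdeal_le (F : MinimalFreeResolution R M)
    (hmS : (maximalIdeal R).map (algebraMap R S) = maximalIdeal S)
    (hm : ∀ r ∈ xs, r ∈ maximalIdeal S) (hregM : IsWeaklyRegular (S ⊗[R] M) xs)
    (h : maximalIdeal S ≤ Ideal.ofList xs) : Module.Free R M := by
  have hbε : Function.Exact ((F.d 0).baseChange S) (F.ε.baseChange S) :=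
    Module.Flat.lTensor_exact S F.exact_ε
  have hsε : Function.Surjective (F.ε.baseChange S) := LinearMap.lTensor_surjective S F.surjective_ε
  have h1 : (F.d 0).baseChange S = 0 := by
    refine eq_zero_of_range_le hsε hbε hm hregM ?_
    refine (range_baseChange_le (F.minimal 0)).trans ?_
    rw [hmS]
    exact Submodule.smul_mono_left h
  have h0 : F.d 0 = 0 := by
    rw [Module.FaithfullyFlat.zero_iff_lTensor_zero R S]
    exact LinearMap.ext fun y ↦ LinearMap.congr_fun h1 y
  have hε : Function.Injective F.ε := by
    rw [injective_iff_map_eq_zero]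
    intro y hy
    obtain ⟨z, rfl⟩ := (F.exact_ε y).mp hy
    rw [h0, LinearMap.zero_apply]
  exact .of_equiv (.ofBijective F.ε ⟨hε, F.surjective_ε⟩ : (Fin (F.rank 0) → R) ≃ₗ[R] M)

end Resolution

lemma extVanishes_of_free {R : Type u} [CommRing R] (M N : Type u) [AddCommGroup M] [Module R M]
    [AddCommGroup N] [Module R N] [Module.Free R M] {i : ℕ} (hi : 1 ≤ i) :
    ExtVanishes R M N i := by
  obtain ⟨i, rfl⟩ := Nat.exists_eq_add_of_le' hi
  have : Projective (ModuleCat.of R M) :=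
    ModuleCat.projective_of_free (Module.Free.chooseBasis R M)
  exact Abelian.Ext.subsingleton_of_projective _ _ i

lemma torVanishes_of_free {R : Type u} [CommRing R] (M N : Type u) [AddCommGroup M] [Module R M]
    [AddCommGroup N] [Module R N] [Module.Free R N] {i : ℕ} (hi : 1 ≤ i) :
    TorVanishes R M N i := by
  obtain ⟨i, rfl⟩ := Nat.exists_eq_add_of_le' hi
  have : Projective (ModuleCat.of R N) :=
    ModuleCat.projective_of_free (Module.Free.chooseBasis R N)
  exact isZero_Tor_succ_of_projective (ModuleCat.{u} R) _ _ i

end MinMult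

end

theorem theorem4p1 (R : Type u) [CommRing R] [IsLocalRing R] [IsNoetherianRing R]
    (d : ℕ) (hd : ringKrullDim R = d)
    (hCM : MinMult.IsCohenMacaulay R) (hmin : MinMult.HasMinimalMultiplicity R)
    (M N : Type u) [AddCommGroup M] [Module R M] [AddCommGroup N] [Module R N]
    [Nontrivial M] [Nontrivial N]
    (hM : MinMult.IsMaximalCohenMacaulay R M) (hN : MinMult.IsMaximalCohenMacaulay R N)
    (hMs : MinMult.IsImageOfSyzygies R M) (hNs : MinMult.IsImageOfSyzygies R N) :
    List.TFAE [
      ∃ n : ℕ, 1 ≤ n ∧ ∀ i : ℕ, n ≤ i → i ≤ n + d → MinMult.ExtVanishes R M N i,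
      ∀ i : ℕ, 1 ≤ i → MinMult.ExtVanishes R M N i,
      IsRegularLocalRing R,
      ∃ n : ℕ, 1 ≤ n ∧ ∀ i : ℕ, n ≤ i → i ≤ n + d → MinMult.TorVanishes R M N i,
      ∀ i : ℕ, 1 ≤ i → MinMult.TorVanishes R M N i] := by
  have := hM.finite
  have := hN.finite
  have hdepth {L : Type u} [AddCommGroup L] [Module R L] [Nontrivial L]
      (h : (MinMult.depth R L : WithBot ℕ∞) = ringKrullDim R) : MinMult.HasDepth R d L :=
    MinMult.hasDepth_of_depth_eq (WithBot.coe_injective (h.trans hd))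
  obtain ⟨xs, rfl, hm, hreg, hregM, hregN, hind, hsq, hiff⟩ :=
    MinMult.exists_isWeaklyRegular_maximalIdeal_sq_le hd hmin M N (hdepth hCM)
      (hdepth hM.depth_eq) (hdepth hN.depth_eq)
  have hmS := MinMult.map_maximalIdeal_genericExtension R
  have hkM := hMs.maximalIdeal_smul_le hmS hm hreg hind hsq
  have hkN := hNs.maximalIdeal_smul_le hmS hm hreg hind hsq
  let F := MinMult.minimalFreeResolution (R := R) M
  let G := MinMult.minimalFreeResolution (R := R) N
  tfae_have 2 → 1 := fun h ↦ ⟨1, le_rfl, fun i hi _ ↦ h i hi⟩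
  tfae_have 5 → 4 := fun h ↦ ⟨1, le_rfl, fun i hi _ ↦ h i hi⟩
  tfae_have 1 → 3 := by
    rintro ⟨n, hn, h⟩
    obtain ⟨n, rfl⟩ := Nat.exists_eq_add_of_le' hn
    exact hiff.mpr (F.maximalIdeal_le_of_rank_eq_zero hmS hreg hregM hkM hsq
      (F.rank_eq_zero_of_extVanishes hmS hm hregN hkN n h))
  tfae_have 4 → 3 := by
    rintro ⟨n, hn, h⟩
    obtain ⟨n, rfl⟩ := Nat.exists_eq_add_of_le' hn
    -- The roles are exchanged: `N` is resolved, and `M` modulo `xs` supplies the vector space of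
    -- coefficients.
    exact hiff.mpr (G.maximalIdeal_le_of_rank_eq_zero hmS hreg hregN hkN hsq
      (G.rank_eq_zero_of_torVanishes hmS hm hregM hkM n h))
  tfae_have 3 → 2 := by
    intro h i hi
    have := F.free_of_maximalIdeal_le hmS hm hregM (hiff.mp h)
    exact MinMult.extVanishes_of_free M N hi
  tfae_have 3 → 5 := by
    intro h i hi
    have := G.free_of_maximalIdeal_le hmS hm hregN (hiff.mp h)
    exact MinMult.torVanishes_of_free M N hi
  tfae_finish
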